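/- **Setting.** Let $p\ge 1$, let $L:\mathbb R^p\to\mathbb R$ be twice continuously differentiable with gradient $\boldsymbol g$ and Hessian $\boldsymbol H(\cdot)$, and let $\boldsymbol\theta^*$ satisfy $\boldsymbol g(\boldsymbol\theta^*)=\boldsymbol 0$. On a probability space with a filtration $(\mathcal F_k)_{k\ge0}$, consider the second-order stochastic approximation algorithm started at a deterministic $\hat{\boldsymbol\theta}_0$ and a symmetric $\overline{\boldsymbol H}_{-1}$: for $k=0,1,\dots$ $$\hat{\boldsymbol\theta}_{k+1}=\hat{\boldsymbol\theta}_k-a_k\boldsymbol d_k,\quad \boldsymbol d_k=\overline{\overline{\boldsymbol H}}_k^{-1}\boldsymbol G_k,\qquad \overline{\boldsymbol H}_k=(1-w_k)\overline{\boldsymbol H}_{k-1}+w_k\hat{\boldsymbol H}_k,\qquad \hat{\boldsymbol H}_k=\tfrac12\Big[\tfrac{\delta\boldsymbol G_k}{2c_k}\boldsymbol\Delta_k^{-\mathsf T}+\big(\tfrac{\delta\boldsymbol G_k}{2c_k}\boldsymbol\Delta_k^{-\mathsf T}\big)^{\mathsf T}\Big],$$ where $\boldsymbol\Delta_k^{-1}$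 is the vector of reciprocals of the components of $\boldsymbol\Delta_k$, and in one of the two settings * (2SPSA) $\boldsymbol G_k=\frac{y_k^+-y_k^-}{2c_k}\boldsymbol\Delta_k^{-1}$ and $\delta\boldsymbol G_k=\frac{\tilde y_k^+-y_k^+}{\tilde c_k}\tilde{\boldsymbol\Delta}_k^{-1}-\frac{\tilde y_k^--y_k^-}{\tilde c_k}\tilde{\boldsymbol\Delta}_k^{-1}$, with noisy measurements $y_k^\pm$ of $L(\hat{\boldsymbol\theta}_k\pm c_k\boldsymbol\Delta_k)$ and $\tilde y_k^\pm$ of $L(\hat{\boldsymbol\theta}_k\pm c_k\boldsymbol\Delta_k+\tilde c_k\tilde{\boldsymbol\Delta}_k)$; * (2SG) $\boldsymbol G_k=\boldsymbol Y_k$ and $\delta\boldsymbol G_k=\boldsymbol Y_k^+-\boldsymbol Y_k^-$, with noisy measurements $\boldsymbol Y_k$ of $\boldsymbol g(\hat{\boldsymbol\theta}_k)$ and $\boldsymbol Y_k^\pm$ of $\boldsymbol g(\hat{\boldsymbol\theta}_k\pm c_k\boldsymbol\Delta_k)$. **Preconditioning.** For every $k$ and every sample point, $\boldsymbol P_k\overline{\boldsymbol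 H}_k\boldsymbol P_k^{\mathsf T}=\boldsymbol L_k\boldsymbol B_k\boldsymbol L_k^{\mathsf T}$ is a symmetric indefinite factorization ($\boldsymbol P_k$ a permutation matrix, $\boldsymbol L_k$ unit lower triangular, $\boldsymbol B_k$ symmetric and block diagonal with blocks of size $1\times1$ or $2\times2$), $\boldsymbol B_k=\boldsymbol Q_k\,\mathrm{diag}(\lambda_{k1},\dots,\lambda_{kp})\,\boldsymbol Q_k^{\mathsf T}$ with $\boldsymbol Q_k$ orthogonal, and, for a constant $\underline\tau>0$, $$\overline{\overline{\boldsymbol H}}_k=\boldsymbol P_k^{\mathsf T}\boldsymbol L_k\boldsymbol Q_k\,\mathrm{diag}\big(\max\{\underline\tau,|\lambda_{kj}|\}\big)_j\,\boldsymbol Q_k^{\mathsf T}\boldsymbol L_k^{\mathsf T}\boldsymbol P_k .$$ The constant $\overline\sigma>0$ satisfies $\sigma_{\max}(\boldsymbol L_k)\le\overline\sigma$ for all $k$ and all sample points. **Regularity conditions.** 1. (Gains) $a_k,c_k>0$, $0<w_k\le1$, $c_k\to0$, $\sum a_k=\infty$, $\sum w_k=\infty$. For 2SPSA: $\tilde c_k>0$,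 $\tilde c_k\to0$, $\sum (a_k/c_k)^2<\infty$, $\sum (w_k/(c_k\tilde c_k))^2<\infty$. For 2SG: $\sum a_k^2<\infty$, $\sum (w_k/c_k)^2<\infty$. 2. (Perturbations) The measurements, the perturbations and $\overline{\overline{\boldsymbol H}}_k$ of iteration $k$ are $\mathcal F_{k+1}$-measurable. The components of $\boldsymbol\Delta_k$ (for 2SPSA, of $\boldsymbol\Delta_k$ and $\tilde{\boldsymbol\Delta}_k$ together) are mutually independent, jointly independent of $\mathcal F_k$, symmetrically distributed about $0$, almost surely nonzero, uniformly bounded, and their reciprocals have uniformly bounded second moments. 3. (Noise) All noises (measurement minus exact value) are integrable. For 2SPSA, with $\varepsilon_k^\pm,\tilde\varepsilon_k^\pm$ the noises of $y_k^\pm,\tilde y_k^\pm$: $\mathbb E[\varepsilon_k^+-\varepsilon_k^-\mid\mathcal F_k,\boldsymbol\Delta_k]=0$ and $\mathbb E[\tilde\varepsilon_k^\pm-\varepsilon_k^\pm\mid\mathcal F_k,\boldsymbol\Delta_k,\tilde{\boldsymbol\Delta}_k]=0$. For 2SG, with $\boldsymbol e_k,\boldsymbol e_k^\pm$ the noises of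 $\boldsymbol Y_k,\boldsymbol Y_k^\pm$: $\mathbb E[\boldsymbol e_k\mid\mathcal F_k,\overline{\overline{\boldsymbol H}}_k]=\boldsymbol0$ and $\mathbb E[\boldsymbol e_k^+-\boldsymbol e_k^-\mid\mathcal F_k,\boldsymbol\Delta_k]=\boldsymbol0$. 4. (Moments) The following have second moments bounded uniformly in $k$ and in the indices. For 2SPSA: $y_k^\pm/\Delta_{ki}$, $y_k^\pm/(\Delta_{ki}\tilde\Delta_{kj})$, $\tilde y_k^\pm/(\Delta_{ki}\tilde\Delta_{kj})$. For 2SG: $\|\boldsymbol Y_k\|$, $Y^\pm_{ki}/\Delta_{kj}$. 5. (Search direction) For every $\eta>0$ there is $r>0$ such that, almost surely, for all sufficiently large $k$: if $\|\hat{\boldsymbol\theta}_k-\boldsymbol\theta^*\|\ge\eta$, then, for 2SG, $(\hat{\boldsymbol\theta}_k-\boldsymbol\theta^*)^{\mathsf T}\overline{\overline{\boldsymbol H}}_k^{-1}\boldsymbol g(\hat{\boldsymbol\theta}_k)\ge r$ and, for 2SPSA, $\mathbb E[(\hat{\boldsymbol\theta}_k-\boldsymbol\theta^*)^{\mathsf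 T}\boldsymbol d_k\mid\mathcal F_k]\ge r$. **Theorem.** Assume that $\boldsymbol H(\boldsymbol\theta^*)$ is positive definite and that $0<\underline\tau\le\lambda_{\min}(\boldsymbol H(\boldsymbol\theta^*))/(2\overline\sigma^2)$. Then almost surely there exists $K_1$ such that $\overline{\overline{\boldsymbol H}}_k=\overline{\boldsymbol H}_k$ for all $k>K_1$. -/

import Mathlib

open MeasureTheory ProbabilityTheory Filter Topology
open scoped Matrix InnerProductSpace

noncomputable section

namespace SecondOrderSP

/-- Parameter space: `ℝ^p` with its Euclidean norm. -/
abbrev Vec (p : ℕ) := EuclideanSpace ℝ (Fin p)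

abbrev Mat (p : ℕ) := Matrix (Fin p) (Fin p) ℝ

/-! ### Deterministic linear algebra -/

/-- The Hessian matrix of `loss` at `x`. -/
def hessian {p : ℕ} (loss : Vec p → ℝ) (x : Vec p) : Mat p :=
  Matrix.of fun i j =>
    fderiv ℝ (fderiv ℝ loss) x (EuclideanSpace.single i 1) (EuclideanSpace.single j 1)

/-- The least eigenvalue of a symmetric matrix. -/
def lambdaMin {p : ℕ} {A : Mat p} (hA : A.IsHermitian) : ℝ := ⨅ i, hA.eigenvalues i

/-- The largest singular value, i.e. the operator norm for the Euclidean norm. -/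
def sigmaMax {p : ℕ} (A : Mat p) : ℝ := ‖Matrix.toEuclideanCLM (n := Fin p) (𝕜 := ℝ) A‖

/-- Block diagonal with consecutive diagonal blocks of size `1 × 1` or `2 × 2`;
`blk i` is the number of the block that contains the index `i`. -/
def IsBlockDiagonalOneTwo {p : ℕ} (B : Mat p) : Prop :=
  ∃ blk : Fin p → ℕ, Monotone blk ∧
    (∀ m : ℕ, (Finset.univ.filter fun i => blk i = m).card ≤ 2) ∧
    ∀ i j, blk i ≠ blk j → B i j = 0

/-- A symmetric indefinite factorization `P A Pᵀ = L B Lᵀ`. -/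
structure IsLBL {p : ℕ} (A P L B : Mat p) : Prop where
  perm : ∃ s : Equiv.Perm (Fin p), P = s.permMatrix ℝ
  lower : ∀ i j, i < j → L i j = 0
  unit_diag : ∀ i, L i i = 1
  symm : B.IsSymm
  block : IsBlockDiagonalOneTwo B
  factor : P * A * Pᵀ = L * B * Lᵀ

/-- An eigendecomposition `B = Q diag(lam) Qᵀ` with `Q` orthogonal. -/
structure IsEigenDecomposition {p : ℕ} (B Q : Mat p) (lam : Fin p → ℝ) : Prop where
  orthogonal : Q ∈ Matrix.orthogonalGroup (Fin p) ℝ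
  factor : B = Q * Matrix.diagonal lam * Qᵀ

/-- Preconditioning: each eigenvalue `lam j` of `B` is replaced by `max τ |lam j|`. -/
def precondition {p : ℕ} (τ : ℝ) (P L Q : Mat p) (lam : Fin p → ℝ) : Mat p :=
  Pᵀ * L * Q * Matrix.diagonal (fun j => max τ |lam j|) * Qᵀ * Lᵀ * P

/-! ### Simultaneous perturbation estimates -/

/-- The vector of reciprocals of the components. -/
def recip {p : ℕ} (v : Vec p) : Vec p := WithLp.toLp 2 fun i => (v i)⁻¹

/-- Two-sided gradient estimate from the measurements `yp` at `θ + cΔ` and `ym` at `θ - cΔ`. -/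
def twoSidedGrad {p : ℕ} (c yp ym : ℝ) (Δ : Vec p) : Vec p :=
  ((yp - ym) / (2 * c)) • recip Δ

/-- One-sided gradient estimate from the measurements `yt` at `x + c'Δ'` and `y` at `x`. -/
def oneSidedGrad {p : ℕ} (c' yt y : ℝ) (Δ' : Vec p) : Vec p :=
  ((yt - y) / c') • recip Δ'

/-- The per-iteration Hessian estimate
`(1/2) [ (δG / 2c) (Δ⁻¹)ᵀ + ((δG / 2c) (Δ⁻¹)ᵀ)ᵀ ]`. -/
def hessEstimate {p : ℕ} (c : ℝ) (δG Δ : Vec p) : Mat p :=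
  let M : Mat p := Matrix.of fun i j => (δG i / (2 * c)) * (recip Δ) j
  (1 / 2 : ℝ) • (M + Mᵀ)

/-! ### The algorithm -/

/-- Gain sequences: step sizes `a`, perturbation sizes `c`, averaging weights `w`. -/
structure Gains where
  a : ℕ → ℝ
  c : ℕ → ℝ
  w : ℕ → ℝ

/-- The random sequences produced by the algorithm. -/
structure Run (Ω : Type*) (p : ℕ) where
  /-- iterates -/
  θ : ℕ → Ω → Vec p
  /-- perturbations -/
  Δ : ℕ → Ω → Vec p
  /-- gradient estimates at the iterates -/
  G : ℕ → Ω → Vec p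
  /-- differences of the gradient estimates at `θ + cΔ` and `θ - cΔ` -/
  δG : ℕ → Ω → Vec p
  /-- averaged Hessian estimates -/
  Hbar : ℕ → Ω → Mat p
  P : ℕ → Ω → Mat p
  L : ℕ → Ω → Mat p
  B : ℕ → Ω → Mat p
  Q : ℕ → Ω → Mat p
  lam : ℕ → Ω → Fin p → ℝ

/-- The preconditioned Hessian estimate. -/
def Run.Hbb {Ω : Type*} {p : ℕ} (R : Run Ω p) (τ : ℝ) (k : ℕ) (ω : Ω) : Mat p :=
  precondition τ (R.P k ω) (R.L k ω) (R.Q k ω) (R.lam k ω)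

/-- The search direction: preconditioned Hessian estimate inverse times gradient estimate. -/
def Run.dir {Ω : Type*} {p : ℕ} (R : Run Ω p) (τ : ℝ) (k : ℕ) (ω : Ω) : Vec p :=
  WithLp.toLp 2 ((R.Hbb τ k ω)⁻¹ *ᵥ (R.G k ω).ofLp)

/-- The recursions of the algorithm, started at the iterate `θ₀` and the Hessian estimate `H₀`. -/
structure Run.Follows {Ω : Type*} {p : ℕ} (R : Run Ω p) (g : Gains) (τ : ℝ)
    (θ₀ : Vec p) (H₀ : Mat p) : Prop where
  theta_zero : ∀ ω, R.θ 0 ω = θ₀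
  theta_succ : ∀ k ω, R.θ (k + 1) ω = R.θ k ω - g.a k • R.dir τ k ω
  hbar_zero : ∀ ω,
    R.Hbar 0 ω = (1 - g.w 0) • H₀ + g.w 0 • hessEstimate (g.c 0) (R.δG 0 ω) (R.Δ 0 ω)
  hbar_succ : ∀ k ω, R.Hbar (k + 1) ω = (1 - g.w (k + 1)) • R.Hbar k ω +
    g.w (k + 1) • hessEstimate (g.c (k + 1)) (R.δG (k + 1) ω) (R.Δ (k + 1) ω)
  lbl : ∀ k ω, IsLBL (R.Hbar k ω) (R.P k ω) (R.L k ω) (R.B k ω)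
  eigen : ∀ k ω, IsEigenDecomposition (R.B k ω) (R.Q k ω) (R.lam k ω)

/-! ### Regularity conditions -/

/-- Conditions on the gains common to both settings. -/
structure Gains.Admissible (g : Gains) : Prop where
  a_pos : ∀ k, 0 < g.a k
  c_pos : ∀ k, 0 < g.c k
  w_pos : ∀ k, 0 < g.w k
  w_le_one : ∀ k, g.w k ≤ 1
  c_tendsto : Tendsto g.c atTop (𝓝 0)
  a_sum : Tendsto (fun n => ∑ k ∈ Finset.range n, g.a k) atTop atTop
  w_sum : Tendsto (fun n => ∑ k ∈ Finset.range n, g.w k) atTop atTop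

/-- `X k i` (`i : ι`) are the perturbation components drawn at iteration `k`: independent of the
past and of each other, symmetric about `0`, bounded, nonzero, with bounded inverse moments. -/
structure IsPerturbation {Ω ι : Type*} {mΩ : MeasurableSpace Ω} (μ : Measure Ω)
    (ℱ : Filtration ℕ mΩ) (X : ℕ → ι → Ω → ℝ) (ρ : ℝ) : Prop where
  meas : ∀ k i, Measurable[ℱ (k + 1)] (X k i)
  indep_past : ∀ k,
    Indep (MeasurableSpace.comap (fun ω i => X k i ω) inferInstance) (ℱ k) μ
  indep : ∀ k, iIndepFun (X k) μ
  symm : ∀ k i, IdentDistrib (X k i) (fun ω => -X k i ω) μ μ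
  bdd : ∀ k i, ∀ᵐ ω ∂μ, |X k i ω| ≤ ρ
  ne_zero : ∀ k i, ∀ᵐ ω ∂μ, X k i ω ≠ 0
  inv_moment : ∀ k i, eLpNorm (fun ω => (X k i ω)⁻¹) 2 μ ≤ ENNReal.ofReal ρ

/-- The averaged search direction condition: whenever `θ_k` stays away from `θs`, the search
direction at late iterations has, in conditional mean given the past, a component along
`θ_k - θs` that is bounded below by a positive constant. -/
def Run.MeanDescent {Ω : Type*} {p : ℕ} {mΩ : MeasurableSpace Ω} (R : Run Ω p) (μ : Measure Ω)
    (ℱ : Filtration ℕ mΩ) (τ : ℝ) (θs : Vec p) : Prop :=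
  ∀ η : ℝ, 0 < η → ∃ r : ℝ, 0 < r ∧ ∀ᵐ ω ∂μ, ∀ᶠ k in atTop,
    η ≤ ‖R.θ k ω - θs‖ → r ≤ (μ[fun ω' => ⟪R.θ k ω' - θs, R.dir τ k ω'⟫_ℝ | ℱ k]) ω

/-- The search direction condition for the noise-free direction: preconditioned Hessian estimate
inverse times the true gradient at `θ_k`. -/
def Run.Descent {Ω : Type*} {p : ℕ} {mΩ : MeasurableSpace Ω} (R : Run Ω p) (μ : Measure Ω)
    (loss : Vec p → ℝ) (τ : ℝ) (θs : Vec p) : Prop :=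
  ∀ η : ℝ, 0 < η → ∃ r : ℝ, 0 < r ∧ ∀ᵐ ω ∂μ, ∀ᶠ k in atTop,
    η ≤ ‖R.θ k ω - θs‖ → r ≤ ⟪R.θ k ω - θs,
      (WithLp.toLp 2 ((R.Hbb τ k ω)⁻¹ *ᵥ (gradient loss (R.θ k ω)).ofLp) : Vec p)⟫_ℝ

/-- The gradient-free setting (2SPSA). At iteration `k` the noisy loss measurements `yp`, `ym`,
`ytp`, `ytm` are taken at `θ + cΔ`, `θ - cΔ`, `θ + cΔ + c'Δ'`, `θ - cΔ + c'Δ'`. -/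
structure Is2SPSA {Ω : Type*} {p : ℕ} {mΩ : MeasurableSpace Ω} (R : Run Ω p) (μ : Measure Ω)
    (ℱ : Filtration ℕ mΩ) (g : Gains) (τ : ℝ) (θs : Vec p) (loss : Vec p → ℝ) (c' : ℕ → ℝ)
    (Δ' : ℕ → Ω → Vec p) (yp ym ytp ytm : ℕ → Ω → ℝ) (ρ : ℝ) : Prop where
  G_eq : ∀ k ω, R.G k ω = twoSidedGrad (g.c k) (yp k ω) (ym k ω) (R.Δ k ω)
  δG_eq : ∀ k ω, R.δG k ω = oneSidedGrad (c' k) (ytp k ω) (yp k ω) (Δ' k ω)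
    - oneSidedGrad (c' k) (ytm k ω) (ym k ω) (Δ' k ω)
  c'_pos : ∀ k, 0 < c' k
  c'_tendsto : Tendsto c' atTop (𝓝 0)
  a_summable : Summable fun k => (g.a k / g.c k) ^ 2
  w_summable : Summable fun k => (g.w k / (g.c k * c' k)) ^ 2
  perturbation : IsPerturbation μ ℱ
    (fun k (s : Fin p ⊕ Fin p) ω => Sum.elim (fun i => R.Δ k ω i) (fun i => Δ' k ω i) s) ρ
  meas_yp : ∀ k, Measurable[ℱ (k + 1)] (yp k)
  meas_ym : ∀ k, Measurable[ℱ (k + 1)] (ym k)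
  meas_ytp : ∀ k, Measurable[ℱ (k + 1)] (ytp k)
  meas_ytm : ∀ k, Measurable[ℱ (k + 1)] (ytm k)
  /-- the measurement noises are integrable -/
  int_yp : ∀ k, Integrable (fun ω => yp k ω - loss (R.θ k ω + g.c k • R.Δ k ω)) μ
  int_ym : ∀ k, Integrable (fun ω => ym k ω - loss (R.θ k ω - g.c k • R.Δ k ω)) μ
  int_ytp : ∀ k, Integrable
    (fun ω => ytp k ω - loss (R.θ k ω + g.c k • R.Δ k ω + c' k • Δ' k ω)) μ
  int_ytm : ∀ k, Integrable
    (fun ω => ytm k ω - loss (R.θ k ω - g.c k • R.Δ k ω + c' k • Δ' k ω)) μ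
  /-- the noise differences have conditional mean zero, given the past and the perturbations -/
  noise_grad : ∀ k, μ[fun ω =>
      (yp k ω - loss (R.θ k ω + g.c k • R.Δ k ω))
        - (ym k ω - loss (R.θ k ω - g.c k • R.Δ k ω))
      | ℱ k ⊔ MeasurableSpace.comap (R.Δ k) inferInstance] =ᵐ[μ] 0
  noise_plus : ∀ k, μ[fun ω =>
      (ytp k ω - loss (R.θ k ω + g.c k • R.Δ k ω + c' k • Δ' k ω))
        - (yp k ω - loss (R.θ k ω + g.c k • R.Δ k ω))
      | (ℱ k ⊔ MeasurableSpace.comap (R.Δ k) inferInstance)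
          ⊔ MeasurableSpace.comap (Δ' k) inferInstance] =ᵐ[μ] 0
  noise_minus : ∀ k, μ[fun ω =>
      (ytm k ω - loss (R.θ k ω - g.c k • R.Δ k ω + c' k • Δ' k ω))
        - (ym k ω - loss (R.θ k ω - g.c k • R.Δ k ω))
      | (ℱ k ⊔ MeasurableSpace.comap (R.Δ k) inferInstance)
          ⊔ MeasurableSpace.comap (Δ' k) inferInstance] =ᵐ[μ] 0
  /-- second moments for the gradient estimate -/
  moment_yp : ∀ k i, eLpNorm (fun ω => yp k ω / R.Δ k ω i) 2 μ ≤ ENNReal.ofReal ρ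
  moment_ym : ∀ k i, eLpNorm (fun ω => ym k ω / R.Δ k ω i) 2 μ ≤ ENNReal.ofReal ρ
  /-- second moments for the Hessian estimate -/
  moment_yp' : ∀ k i j,
    eLpNorm (fun ω => yp k ω / (R.Δ k ω i * Δ' k ω j)) 2 μ ≤ ENNReal.ofReal ρ
  moment_ym' : ∀ k i j,
    eLpNorm (fun ω => ym k ω / (R.Δ k ω i * Δ' k ω j)) 2 μ ≤ ENNReal.ofReal ρ
  moment_ytp : ∀ k i j,
    eLpNorm (fun ω => ytp k ω / (R.Δ k ω i * Δ' k ω j)) 2 μ ≤ ENNReal.ofReal ρ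
  moment_ytm : ∀ k i j,
    eLpNorm (fun ω => ytm k ω / (R.Δ k ω i * Δ' k ω j)) 2 μ ≤ ENNReal.ofReal ρ
  descent : R.MeanDescent μ ℱ τ θs

/-- The gradient-based setting (2SG). At iteration `k` the noisy gradient measurements `Y`, `Yp`,
`Ym` are taken at `θ`, `θ + cΔ`, `θ - cΔ`. -/
structure Is2SG {Ω : Type*} {p : ℕ} {mΩ : MeasurableSpace Ω} (R : Run Ω p) (μ : Measure Ω)
    (ℱ : Filtration ℕ mΩ) (g : Gains) (τ : ℝ) (θs : Vec p) (loss : Vec p → ℝ)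
    (Y Yp Ym : ℕ → Ω → Vec p) (ρ : ℝ) : Prop where
  G_eq : ∀ k ω, R.G k ω = Y k ω
  δG_eq : ∀ k ω, R.δG k ω = Yp k ω - Ym k ω
  a_summable : Summable fun k => g.a k ^ 2
  w_summable : Summable fun k => (g.w k / g.c k) ^ 2
  perturbation : IsPerturbation μ ℱ (fun k (i : Fin p) ω => R.Δ k ω i) ρ
  meas_Y : ∀ k, Measurable[ℱ (k + 1)] (Y k)
  meas_Yp : ∀ k, Measurable[ℱ (k + 1)] (Yp k)
  meas_Ym : ∀ k, Measurable[ℱ (k + 1)] (Ym k)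
  /-- the measurement noises are integrable -/
  int_Y : ∀ k, Integrable (fun ω => Y k ω - gradient loss (R.θ k ω)) μ
  int_Yp : ∀ k, Integrable (fun ω => Yp k ω - gradient loss (R.θ k ω + g.c k • R.Δ k ω)) μ
  int_Ym : ∀ k, Integrable (fun ω => Ym k ω - gradient loss (R.θ k ω - g.c k • R.Δ k ω)) μ
  /-- the noise of `Y` has conditional mean zero, given the past and the preconditioned Hessian
  estimate of the iteration -/
  noise_grad : ∀ k, μ[fun ω => Y k ω - gradient loss (R.θ k ω)
      | ℱ k ⊔ MeasurableSpace.comap (fun ω i j => R.Hbb τ k ω i j)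
          (inferInstanceAs (MeasurableSpace (Fin p → Fin p → ℝ)))] =ᵐ[μ] 0
  /-- the noise difference has conditional mean zero, given the past and the perturbation -/
  noise : ∀ k, μ[fun ω =>
      (Yp k ω - gradient loss (R.θ k ω + g.c k • R.Δ k ω))
        - (Ym k ω - gradient loss (R.θ k ω - g.c k • R.Δ k ω))
      | ℱ k ⊔ MeasurableSpace.comap (R.Δ k) inferInstance] =ᵐ[μ] 0
  /-- second moments for the gradient estimate -/
  moment_Y : ∀ k, eLpNorm (Y k) 2 μ ≤ ENNReal.ofReal ρ
  /-- second moments for the Hessian estimate -/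
  moment_Yp : ∀ k i j, eLpNorm (fun ω => Yp k ω i / R.Δ k ω j) 2 μ ≤ ENNReal.ofReal ρ
  moment_Ym : ∀ k i j, eLpNorm (fun ω => Ym k ω i / R.Δ k ω j) 2 μ ≤ ENNReal.ofReal ρ
  descent : R.Descent μ loss τ θs

end SecondOrderSP

end

noncomputable section

namespace SecondOrderSP

/-! ### Series and weighted averages -/

/-! Once `Hbar` is close to the positive definite Hessian `H` at `θs`, its quadratic form is at
least `lambdaMin / 2` times the squared norm. Testing it on suitable vectors of norm at least `1 /
σ` shows that every eigenvalue of the block factor `B` is at least `lambdaMin / (2 * σ ^ 2)`, hence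
at least `τ`. Then `max τ |lam j| = lam j`, and the preconditioned matrix multiplies back to `Hbar`
(`precondition_eq`). It remains to prove that `Hbar` converges to `H` almost surely, entry by entry.

This requires convergence of the iterates. The unit triangular factor has determinant one and
bounded entries, so the inverse preconditioned matrices are uniformly bounded
(`exists_abs_inv_precondition_le`) and the search directions inherit second moments from the
gradient estimates. The Lyapunov function is the distance to `θs`, not its square: the noise then
carries the weight `1 / max η ‖x‖`, which cancels the factor `‖x‖` in the inner product, so the
martingale is bounded in L² without any a priori bound on the iterates. The descent condition and
the divergence of the step sizes do the rest, path by path (`tendsto_zero_of_descent`).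

For the Hessian, the averaging recursion is linear in its input, so the error of a per-iteration
estimate can be split into parts that are averaged separately. Measurement noise is a martingale
difference; its weighted series converges (`ae_seriesConverges_sub_condExp`), and a Kronecker
argument makes its averages vanish. The leading term of the expansion at `θs` contains ratios of
perturbation components, whose means are Kronecker deltas and select one Hessian entry; the
fluctuations are again handled by a convergent series. The remainder is eventually at most `ε` times
reciprocals of perturbation components, by strict differentiability of the derivative at `θs`, and
the averages of those reciprocals stay bounded (`ae_averagesToZero_of_small`). -/

/-- The partial sums of `s` converge, possibly only conditionally. -/
def SeriesConverges (s : ℕ → ℝ) : Prop :=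
  ∃ l, Tendsto (fun n => ∑ k ∈ Finset.range n, s k) atTop (𝓝 l)

theorem _root_.Summable.seriesConverges {s : ℕ → ℝ} (h : Summable s) : SeriesConverges s :=
  ⟨_, h.hasSum.tendsto_sum_nat⟩

theorem SeriesConverges.add {s t : ℕ → ℝ} (hs : SeriesConverges s) (ht : SeriesConverges t) :
    SeriesConverges (fun k => s k + t k) := by
  obtain ⟨l, hl⟩ := hs
  obtain ⟨m, hm⟩ := ht
  exact ⟨l + m, by simpa only [Finset.sum_add_distrib] using hl.add hm⟩

theorem SeriesConverges.const_mul {s : ℕ → ℝ} (hs : SeriesConverges s) (b : ℝ) :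
    SeriesConverges (fun k => b * s k) := by
  obtain ⟨l, hl⟩ := hs
  exact ⟨b * l, by simpa only [Finset.mul_sum] using hl.const_mul b⟩

theorem SeriesConverges.sum {ι : Type*} (S : Finset ι) {s : ι → ℕ → ℝ}
    (hs : ∀ i ∈ S, SeriesConverges (s i)) : SeriesConverges (fun k => ∑ i ∈ S, s i k) := by
  classical
  induction S using Finset.induction_on with
  | empty => exact ⟨0, by simp⟩
  | insert i S hi ih =>
    simp only [Finset.sum_insert hi]
    exact (hs i (Finset.mem_insert_self i S)).add
      (ih fun j hj => hs j (Finset.mem_insert_of_mem hj))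

/-- Averaging the sequence `X` with the weights `w` gives a null sequence, from any start. -/
def AveragesToZero (w X : ℕ → ℝ) : Prop :=
  ∀ A : ℕ → ℝ, (∀ k, A (k + 1) = (1 - w k) * A k + w k * X k) → Tendsto A atTop (𝓝 0)

/-- Admissible averaging weights. -/
structure IsWeight (w : ℕ → ℝ) : Prop where
  pos : ∀ k, 0 < w k
  le_one : ∀ k, w k ≤ 1
  sum : Tendsto (fun n => ∑ k ∈ Finset.range n, w k) atTop atTop

/-- Each step multiplies the excess over `ε` by at most `1 - w k ≤ exp (-w k)`, and the exponents
sum to infinity. -/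
theorem IsWeight.eventually_le {w : ℕ → ℝ} (hw : IsWeight w) {B : ℕ → ℝ} {ε δ : ℝ} (hδ : 0 < δ)
    (h : ∀ᶠ k in atTop, B (k + 1) ≤ (1 - w k) * B k + w k * ε) :
    ∀ᶠ k in atTop, B k ≤ ε + δ := by
  obtain ⟨K, hK⟩ := eventually_atTop.1 h
  set S : ℕ → ℝ := fun n => ∑ k ∈ Finset.range n, w k with hS
  -- Clipped at `0`: the factor `1 - w n` may be replaced by the larger `exp (-w n)` only in front
  -- of a nonnegative quantity.
  set C : ℝ := max (B K - ε) 0 with hC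
  have hC0 : 0 ≤ C := le_max_right _ _
  have key : ∀ n, K ≤ n → B n - ε ≤ C * Real.exp (-(S n - S K)) := by
    intro n hn
    induction n, hn using Nat.le_induction with
    | base => simp [hC]
    | succ n hn ih =>
      have h1 : B (n + 1) - ε ≤ (1 - w n) * (B n - ε) := by linarith [hK n hn]
      have h2 : (1 - w n) * (B n - ε) ≤ (1 - w n) * (C * Real.exp (-(S n - S K))) :=
        mul_le_mul_of_nonneg_left ih (by linarith [hw.le_one n])
      have h3 : (1 - w n) * (C * Real.exp (-(S n - S K)))
          ≤ Real.exp (-w n) * (C * Real.exp (-(S n - S K))) :=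
        mul_le_mul_of_nonneg_right (Real.one_sub_le_exp_neg _) (by positivity)
      have h4 : Real.exp (-w n) * (C * Real.exp (-(S n - S K)))
          = C * Real.exp (-(S (n + 1) - S K)) := by
        rw [mul_left_comm, ← Real.exp_add]
        congr 2
        simp only [hS, Finset.sum_range_succ]
        ring
      linarith
  have hlim : Tendsto (fun n => C * Real.exp (-(S n - S K))) atTop (𝓝 (C * 0)) := by
    refine Tendsto.const_mul C (Real.tendsto_exp_atBot.comp ?_)
    exact tendsto_neg_atTop_atBot.comp (tendsto_atTop_add_const_right _ (-S K) hw.sum)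
  rw [mul_zero] at hlim
  filter_upwards [hlim.eventually (gt_mem_nhds hδ), eventually_ge_atTop K] with n h1 h2
  linarith [key n h2]

theorem IsWeight.abs_le {w : ℕ → ℝ} (hw : IsWeight w) {A X : ℕ → ℝ}
    (hA : ∀ k, A (k + 1) = (1 - w k) * A k + w k * X k) (k : ℕ) :
    |A (k + 1)| ≤ (1 - w k) * |A k| + w k * |X k| := by
  rw [hA k]
  refine (abs_add_le _ _).trans (le_of_eq ?_)
  rw [abs_mul, abs_mul, abs_of_nonneg (by linarith [hw.le_one k] : (0 : ℝ) ≤ 1 - w k),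
    abs_of_pos (hw.pos k)]

/-- The weighted averages of `X`, started at `0`. -/
def weightedAvg (w X : ℕ → ℝ) : ℕ → ℝ
  | 0 => 0
  | k + 1 => (1 - w k) * weightedAvg w X k + w k * X k

/-- The recursion is linear in the pair (average, input): removing the average of `Y` from `A`
leaves an average of `X`. -/
theorem AveragesToZero.add {w X Y : ℕ → ℝ} (hX : AveragesToZero w X) (hY : AveragesToZero w Y) :
    AveragesToZero w (fun k => X k + Y k) := by
  intro A hA
  have h1 := hX (fun k => A k - weightedAvg w Y k) fun k => by
    simp only [hA k, weightedAvg]; ring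
  have h2 := hY (weightedAvg w Y) fun k => rfl
  simpa using h1.add h2

/-- Subtracting `b - 1` copies of the average of `X` leaves input `X`; this avoids dividing by `b`,
which may be zero. -/
theorem AveragesToZero.const_mul {w X : ℕ → ℝ} (hX : AveragesToZero w X) (b : ℝ) :
    AveragesToZero w (fun k => b * X k) := by
  intro A hA
  have h0 := hX (weightedAvg w X) fun k => rfl
  have h1 := hX (fun k => A k - (b - 1) * weightedAvg w X k) fun k => by
    simp only [hA k, weightedAvg]; ring
  simpa using h1.add (h0.const_mul (b - 1))

theorem AveragesToZero.sum {ι : Type*} {w : ℕ → ℝ} (S : Finset ι) {X : ι → ℕ → ℝ}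
    (h0 : AveragesToZero w fun _ => 0)
    (hX : ∀ i ∈ S, AveragesToZero w (X i)) : AveragesToZero w (fun k => ∑ i ∈ S, X i k) := by
  classical
  induction S using Finset.induction_on with
  | empty => simpa using h0
  | insert i S hi ih =>
    simp only [Finset.sum_insert hi]
    exact (hX i (Finset.mem_insert_self i S)).add
      (ih fun j hj => hX j (Finset.mem_insert_of_mem hj))

theorem IsWeight.averagesToZero_of_tendsto {w X : ℕ → ℝ} (hw : IsWeight w)
    (hX : Tendsto X atTop (𝓝 0)) : AveragesToZero w X := by
  intro A hA
  rw [Metric.tendsto_atTop']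
  intro ε hε
  have h : ∀ᶠ k in atTop, |A (k + 1)| ≤ (1 - w k) * |A k| + w k * (ε / 3) := by
    have := Metric.tendsto_nhds.1 hX (ε / 3) (by positivity)
    filter_upwards [this] with k hk
    rw [Real.dist_eq, sub_zero] at hk
    have := mul_le_mul_of_nonneg_left hk.le (hw.pos k).le
    linarith [hw.abs_le hA k]
  obtain ⟨N, hN⟩ := eventually_atTop.1
    (hw.eventually_le (B := fun k => |A k|) (δ := ε / 3) (by positivity) h)
  refine ⟨N, fun n hn => ?_⟩
  rw [Real.dist_eq, sub_zero]
  linarith [hN n hn.le]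

/-- A form of Kronecker's lemma. If `T` is the tail of the series, then `A + T` is itself a weighted
average with input `T`, and `T` is null. -/
theorem IsWeight.averagesToZero_of_seriesConverges {w X : ℕ → ℝ} (hw : IsWeight w)
    (hX : SeriesConverges fun k => w k * X k) : AveragesToZero w X := by
  obtain ⟨l, hl⟩ := hX
  intro A hA
  set T : ℕ → ℝ := fun n => l - ∑ k ∈ Finset.range n, w k * X k with hT
  have hT0 : Tendsto T atTop (𝓝 0) := by simpa using hl.const_sub l
  have h := hw.averagesToZero_of_tendsto hT0 (fun k => A k + T k) fun k => by
    simp only [hA k, hT, Finset.sum_range_succ]; ring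
  simpa using h.sub hT0

/-- A null sequence times a sequence with bounded averages has null averages. -/
theorem IsWeight.averagesToZero_of_small {w X Y C : ℕ → ℝ} (hw : IsWeight w) {b : ℝ}
    (hC : ∀ k, C k ≤ b) (hY : AveragesToZero w fun k => Y k - C k)
    (h : ∀ ε : ℝ, 0 < ε → ∀ᶠ k in atTop, |X k| ≤ ε * Y k) : AveragesToZero w X := by
  intro A hA
  rw [Metric.tendsto_atTop']
  intro ε hε
  -- Chosen so that `e * b ≤ ε / 3`; the summand `1` covers `b = 0`.
  set e : ℝ := ε / (3 * (|b| + 1)) with he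
  have hb0 : 0 < |b| + 1 := by positivity
  have he0 : 0 < e := by positivity
  have heb : e * b ≤ ε / 3 := by
    calc e * b ≤ e * (|b| + 1) :=
          mul_le_mul_of_nonneg_left (by linarith [le_abs_self b]) he0.le
      _ = ε / 3 := by rw [he]; field_simp
  have hZ := (hY.const_mul e) (weightedAvg w fun k => e * (Y k - C k)) fun k => rfl
  -- Subtracting the null average of `e * (Y - C)` from `|A|` leaves a recursion with constant input
  -- `ε / 3`.
  have h1 : ∀ᶠ k in atTop, |A (k + 1)| - weightedAvg w (fun k => e * (Y k - C k)) (k + 1)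
      ≤ (1 - w k) * (|A k| - weightedAvg w (fun k => e * (Y k - C k)) k) + w k * (ε / 3) := by
    filter_upwards [h e he0] with k hk
    have h2 : |X k| ≤ e * (Y k - C k) + ε / 3 := by
      linarith [mul_le_mul_of_nonneg_left (hC k) he0.le]
    have := mul_le_mul_of_nonneg_left h2 (hw.pos k).le
    simp only [weightedAvg]
    linarith [hw.abs_le hA k]
  obtain ⟨N, hN⟩ := eventually_atTop.1
    ((hw.eventually_le (δ := ε / 4) (B := fun k => |A k| -
      weightedAvg w (fun k => e * (Y k - C k)) k) (by positivity)
      h1).and (Metric.tendsto_nhds.1 hZ (ε / 3) (by positivity)))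
  refine ⟨N, fun n hn => ?_⟩
  obtain ⟨h2, h3⟩ := hN n hn.le
  rw [Real.dist_eq, sub_zero] at h3 ⊢
  linarith [le_abs_self (weightedAvg w (fun k => e * (Y k - C k)) n)]

/-! ### Convergence of the iterates on a sample path -/

/-- Above a level `η`, `V` can rise only through increments of a convergent series, while the drift
`r * a k / V k` has divergent sum as long as `V` stays bounded; so `V` must fall below `η`.
Afterwards each excursion starts at most one small step above `η` and gains little. Levels `1 / (n +
1)` suffice and keep the later almost sure statements countable. -/
theorem tendsto_zero_of_decrease {V a s : ℕ → ℝ} (hV : ∀ k, 0 ≤ V k) (ha : ∀ k, 0 < a k)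
    (hsum : Tendsto (fun n => ∑ k ∈ Finset.range n, a k) atTop atTop)
    (hs : Tendsto s atTop (𝓝 0)) (hstep : ∀ k, V (k + 1) ≤ V k + s k)
    (h : ∀ n : ℕ, ∃ r : ℝ, 0 < r ∧ ∃ t : ℕ → ℝ, SeriesConverges t ∧ ∀ᶠ k in atTop,
      1 / ((n : ℝ) + 1) ≤ V k → V (k + 1) ≤ V k - r * a k / V k + t k) :
    Tendsto V atTop (𝓝 0) := by
  rw [Metric.tendsto_atTop']
  intro ε hε
  -- The budget is `ε / 4` each for the level, the overshoot of one step and the increments of the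
  -- series.
  obtain ⟨n, hn⟩ := exists_nat_one_div_lt (show 0 < ε / 4 by positivity)
  set η : ℝ := 1 / ((n : ℝ) + 1) with hη
  have hη0 : 0 < η := by positivity
  obtain ⟨r, hr, t, ⟨l, hl⟩, ht⟩ := h n
  set S : ℕ → ℝ := fun n => ∑ k ∈ Finset.range n, t k with hS
  obtain ⟨K, hK⟩ := eventually_atTop.1
    ((ht.and (Metric.tendsto_nhds.1 hl (ε / 8) (by positivity))).and
      (Metric.tendsto_nhds.1 hs (ε / 4) (by positivity)))
  have hSd : ∀ i j, K ≤ i → K ≤ j → S i - S j < ε / 4 := by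
    intro i j hi hj
    have h1 := (hK i hi).1.2
    have h2 := (hK j hj).1.2
    rw [Real.dist_eq] at h1 h2
    have := le_abs_self (S i - l)
    have := neg_abs_le (S j - l)
    linarith
  have hdec : ∀ k, K ≤ k → η ≤ V k → V (k + 1) ≤ V k - r * a k / V k + t k :=
    fun k hk => (hK k hk).1.1
  have hdec' : ∀ k, K ≤ k → η ≤ V k → V (k + 1) ≤ V k + t k := by
    intro k hk hv
    have : 0 ≤ r * a k / V k := div_nonneg (mul_nonneg hr.le (ha k).le) (hV k)
    linarith [hdec k hk hv]
  have hstep' : ∀ k, K ≤ k → V (k + 1) ≤ V k + ε / 4 := by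
    intro k hk
    have := (hK k hk).2
    rw [Real.dist_eq, sub_zero] at this
    linarith [hstep k, le_abs_self (s k)]
  have hSs : ∀ k, S (k + 1) = S k + t k := fun k => Finset.sum_range_succ _ _
  have enter : ∃ k₀, K ≤ k₀ ∧ V k₀ < η := by
    by_contra! hcon
    have hb : ∀ k, K ≤ k → V k ≤ V K + (S k - S K) := by
      intro k hk
      induction k, hk using Nat.le_induction with
      | base => simp
      | succ k hk ih => linarith [hdec' k hk (hcon k hk), hSs k]
    -- As long as `V` has not entered the region below `η`, it stays below `C`, so the drift is at
    -- least `r / C * a k`.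
    set C : ℝ := V K + ε / 4 with hC
    have hC0 : 0 < C := by linarith [hV K]
    set Sa : ℕ → ℝ := fun n => ∑ k ∈ Finset.range n, a k with hSa
    have hb2 : ∀ k, K ≤ k → V k + r / C * (Sa k - Sa K) ≤ V K + (S k - S K) := by
      intro k hk
      induction k, hk using Nat.le_induction with
      | base => simp
      | succ k hk ih =>
        have h1 : V k ≤ C := by linarith [hb k hk, hSd k K hk le_rfl]
        have h2 : 0 < V k := hη0.trans_le (hcon k hk)
        have h3 : r / C * a k ≤ r * a k / V k := by
          rw [div_mul_eq_mul_div]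
          exact div_le_div_of_nonneg_left (mul_nonneg hr.le (ha k).le) h2 h1
        have h4 : Sa (k + 1) = Sa k + a k := Finset.sum_range_succ _ _
        rw [h4, hSs]
        have := hdec k hk (hcon k hk)
        have h5 : r / C * (Sa k + a k - Sa K) = r / C * (Sa k - Sa K) + r / C * a k := by ring
        linarith
    have hbd : ∀ k, K ≤ k → Sa k ≤ Sa K + C / (r / C) := by
      intro k hk
      have h1 : r / C * (Sa k - Sa K) ≤ C := by
        linarith [hb2 k hk, hSd k K hk le_rfl, hV k]
      have h2 : Sa k - Sa K ≤ C / (r / C) := by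
        rw [le_div_iff₀ (by positivity), mul_comm]
        exact h1
      linarith
    obtain ⟨k, hk1, hk2⟩ := ((hsum.eventually_gt_atTop (Sa K + C / (r / C))).and
      (eventually_ge_atTop K)).exists
    exact absurd (hbd k hk2) (not_le.2 hk1)
  obtain ⟨k₀, hk₀, hVk₀⟩ := enter
  -- `j` is the start of the current excursion: `k₀`, or the time just after the last visit below
  -- `η`.
  have inv : ∀ k, k₀ ≤ k → ∃ j, K ≤ j ∧ V j ≤ η + ε / 4 ∧ V k ≤ V j + (S k - S j) := by
    intro k hk
    induction k, hk using Nat.le_induction with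
    | base => exact ⟨k₀, hk₀, by linarith, by simp⟩
    | succ k hk ih =>
      obtain ⟨j, hj, hj1, hj2⟩ := ih
      by_cases hv : η ≤ V k
      · exact ⟨j, hj, hj1, by linarith [hdec' k (hk₀.trans hk) hv, hSs k]⟩
      · exact ⟨k + 1, hk₀.trans (hk.trans k.le_succ),
          by linarith [hstep' k (hk₀.trans hk), not_le.1 hv], by simp⟩
  refine ⟨k₀, fun k hk => ?_⟩
  obtain ⟨j, hj, hj1, hj2⟩ := inv k hk.le
  rw [Real.dist_eq, sub_zero, abs_of_nonneg (hV k)]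
  linarith [hSd k j (hk₀.trans hk.le) hj]

/-- Expanding `‖x‖` instead of `‖x‖ ^ 2` divides the inner product by `‖x‖`, which keeps the noise
terms under control. The maximum agrees with `‖x k‖` wherever descent is used and keeps the weight
bounded elsewhere. -/
theorem tendsto_zero_of_descent {E : Type*} [NormedAddCommGroup E] [InnerProductSpace ℝ E]
    {x d : ℕ → E} {a : ℕ → ℝ} (ha : ∀ k, 0 < a k)
    (hsum : Tendsto (fun n => ∑ k ∈ Finset.range n, a k) atTop atTop)
    (hx : ∀ k, x (k + 1) = x k - a k • d k)
    (hd : Summable fun k => a k ^ 2 * ‖d k‖ ^ 2)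
    (h : ∀ n : ℕ, ∃ r : ℝ, 0 < r ∧ ∃ m : ℕ → ℝ,
      (∀ᶠ k in atTop, 1 / ((n : ℝ) + 1) ≤ ‖x k‖ → r ≤ m k) ∧
      SeriesConverges fun k => a k * (max (1 / ((n : ℝ) + 1)) ‖x k‖)⁻¹ * (⟪x k, d k⟫_ℝ - m k)) :
    Tendsto x atTop (𝓝 0) := by
  rw [tendsto_zero_iff_norm_tendsto_zero]
  have hs : Tendsto (fun k => a k * ‖d k‖) atTop (𝓝 0) := by
    have h1 := (hd.tendsto_atTop_zero).sqrt
    rw [Real.sqrt_zero] at h1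
    refine h1.congr fun k => ?_
    rw [← mul_pow, Real.sqrt_sq (mul_nonneg (ha k).le (norm_nonneg _))]
  refine tendsto_zero_of_decrease (fun k => norm_nonneg _) ha hsum hs (fun k => ?_) fun n => ?_
  · rw [hx k]
    refine (norm_sub_le _ _).trans ?_
    rw [norm_smul, Real.norm_of_nonneg (ha k).le]
  · obtain ⟨r, hr, m, hm, hconv⟩ := h n
    set η : ℝ := 1 / ((n : ℝ) + 1) with hη
    have hη0 : 0 < η := by positivity
    refine ⟨r, hr, _, (hconv.const_mul (-1)).add
      ((hd.mul_left (1 / (2 * η))).seriesConverges), ?_⟩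
    filter_upwards [hm] with k hmk hk
    have hmr := hmk hk
    have hv : 0 < ‖x k‖ := hη0.trans_le hk
    rw [max_eq_right hk]
    have hsq : ‖x (k + 1)‖ ^ 2
        = ‖x k‖ ^ 2 - 2 * (a k * ⟪x k, d k⟫_ℝ) + a k ^ 2 * ‖d k‖ ^ 2 := by
      rw [hx k, norm_sub_sq_real, inner_smul_right, norm_smul, mul_pow, Real.norm_eq_abs, sq_abs]
    -- The tangent to the concave square root at `‖x k‖ ^ 2` lies above its graph.
    have h1 : ‖x (k + 1)‖ ≤ ‖x k‖ + (‖x (k + 1)‖ ^ 2 - ‖x k‖ ^ 2) / (2 * ‖x k‖) := by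
      rw [← sub_nonneg]
      have : ‖x k‖ + (‖x (k + 1)‖ ^ 2 - ‖x k‖ ^ 2) / (2 * ‖x k‖) - ‖x (k + 1)‖
          = (‖x (k + 1)‖ - ‖x k‖) ^ 2 / (2 * ‖x k‖) := by
        field_simp; ring
      rw [this]; positivity
    have h2 : (‖x (k + 1)‖ ^ 2 - ‖x k‖ ^ 2) / (2 * ‖x k‖)
        = -(a k * m k / ‖x k‖) + -1 * (a k * ‖x k‖⁻¹ * (⟪x k, d k⟫_ℝ - m k))
          + a k ^ 2 * ‖d k‖ ^ 2 / (2 * ‖x k‖) := by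
      rw [hsq]; field_simp; ring
    have h3 : a k ^ 2 * ‖d k‖ ^ 2 / (2 * ‖x k‖) ≤ 1 / (2 * η) * (a k ^ 2 * ‖d k‖ ^ 2) := by
      rw [one_div_mul_eq_div]
      exact div_le_div_of_nonneg_left (by positivity) (by positivity) (by linarith)
    have h4 : r * a k / ‖x k‖ ≤ a k * m k / ‖x k‖ := by
      rw [mul_comm r]
      gcongr
      exact (ha k).le
    linarith

/-! ### Linear algebra of the preconditioned matrix -/

section LinearAlgebra

variable {p : ℕ}

theorem lambdaMin_mul_dotProduct_le {A : Mat p} (hA : A.IsHermitian) (x : Fin p → ℝ) :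
    lambdaMin hA * (x ⬝ᵥ x) ≤ x ⬝ᵥ A *ᵥ x := by
  set U : Mat p := (hA.eigenvectorUnitary : Mat p) with hU
  have hUU : U * Uᵀ = 1 := by
    have := (Unitary.mem_iff.1 hA.eigenvectorUnitary.2).2
    rwa [Matrix.star_eq_conjTranspose, Matrix.conjTranspose_eq_transpose_of_trivial] at this
  have hsp : A = U * Matrix.diagonal hA.eigenvalues * Uᵀ := by
    have := hA.spectral_theorem
    rw [Unitary.conjStarAlgAut_apply, Matrix.star_eq_conjTranspose,
      Matrix.conjTranspose_eq_transpose_of_trivial] at this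
    exact this
  set y := Uᵀ *ᵥ x with hy
  have h1 : x ⬝ᵥ A *ᵥ x = y ⬝ᵥ Matrix.diagonal hA.eigenvalues *ᵥ y := by
    conv_lhs => rw [hsp]
    rw [← Matrix.mulVec_mulVec, ← Matrix.mulVec_mulVec, Matrix.dotProduct_mulVec,
      ← Matrix.mulVec_transpose]
  have h2 : x ⬝ᵥ x = y ⬝ᵥ y := by
    rw [hy, Matrix.dotProduct_mulVec, ← Matrix.mulVec_transpose, Matrix.transpose_transpose,
      Matrix.mulVec_mulVec, hUU, Matrix.one_mulVec]
  rw [h1, h2]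
  simp only [dotProduct, Matrix.mulVec_diagonal, Finset.mul_sum]
  refine Finset.sum_le_sum fun i _ => ?_
  have h3 : lambdaMin hA ≤ hA.eigenvalues i := ciInf_le (Set.finite_range _).bddBelow i
  nlinarith [mul_self_nonneg (y i)]

theorem lambdaMin_pos [NeZero p] {A : Mat p} (hA : A.PosDef) : 0 < lambdaMin hA.isHermitian := by
  have : Nonempty (Fin p) := ⟨0⟩
  obtain ⟨i, hi⟩ := exists_eq_ciInf_of_finite (f := hA.isHermitian.eigenvalues)
  rw [lambdaMin, ← hi]
  exact hA.eigenvalues_pos i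

theorem IsLBL.permMul {A P L B : Mat p} (h : IsLBL A P L B) : P * Pᵀ = 1 := by
  obtain ⟨s, rfl⟩ := h.perm
  rw [Matrix.transpose_permMatrix, ← Matrix.permMatrix_mul]
  simp

theorem IsLBL.permMul' {A P L B : Mat p} (h : IsLBL A P L B) : Pᵀ * P = 1 :=
  mul_eq_one_comm.1 h.permMul

theorem IsLBL.det_eq_one {A P L B : Mat p} (h : IsLBL A P L B) : L.det = 1 := by
  rw [Matrix.det_of_isLowerTriangular L fun i j hij => h.lower i j hij]
  exact Finset.prod_eq_one fun i _ => h.unit_diag i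

theorem IsLBL.mul_inv {A P L B : Mat p} (h : IsLBL A P L B) : L * L⁻¹ = 1 :=
  Matrix.mul_nonsing_inv _ (by rw [h.det_eq_one]; exact isUnit_one)

theorem IsEigenDecomposition.transpose_mul {B Q : Mat p} {lam : Fin p → ℝ}
    (h : IsEigenDecomposition B Q lam) : Qᵀ * Q = 1 := (Matrix.mem_orthogonalGroup_iff' _ _).1 h.1

theorem IsEigenDecomposition.mul_transpose {B Q : Mat p} {lam : Fin p → ℝ}
    (h : IsEigenDecomposition B Q lam) : Q * Qᵀ = 1 := (Matrix.mem_orthogonalGroup_iff _ _).1 h.1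

theorem norm_mulVec_le (L : Mat p) (x : Fin p → ℝ) :
    ‖(WithLp.toLp 2 (L *ᵥ x) : Vec p)‖ ≤ sigmaMax L * ‖(WithLp.toLp 2 x : Vec p)‖ := by
  rw [← Matrix.toEuclideanCLM_toLp (𝕜 := ℝ)]
  exact ContinuousLinearMap.le_opNorm _ _

theorem norm_toLp_sq (x : Fin p → ℝ) : ‖(WithLp.toLp 2 x : Vec p)‖ ^ 2 = x ⬝ᵥ x := by
  rw [EuclideanSpace.norm_sq_eq]
  simp [dotProduct, pow_two]

theorem transpose_mulVec_dotProduct (M N : Mat p) (y : Fin p → ℝ) :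
    (Mᵀ *ᵥ y) ⬝ᵥ N *ᵥ (Mᵀ *ᵥ y) = y ⬝ᵥ (M * N * Mᵀ) *ᵥ y := by
  rw [← Matrix.mulVec_mulVec, ← Matrix.mulVec_mulVec, Matrix.dotProduct_mulVec y,
    ← Matrix.mulVec_transpose]

/-- For a column `v` of `Q`, the vector `z = Pᵀ L⁻ᵀ v` satisfies `zᵀ A z = lam j`. Its norm is at
least `1 / σ`, so `lam j ≥ κ / σ ^ 2 ≥ τ`: the truncation and the absolute value are inactive. -/
theorem precondition_eq {A P L B Q : Mat p} {lam : Fin p → ℝ} {τ σ κ : ℝ} (hlbl : IsLBL A P L B)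
    (heig : IsEigenDecomposition B Q lam) (hσ : 0 < σ) (hL : sigmaMax L ≤ σ) (hκ : 0 ≤ κ)
    (hτ : 0 ≤ τ) (hτκ : τ ≤ κ / σ ^ 2) (hA : ∀ x : Fin p → ℝ, κ * (x ⬝ᵥ x) ≤ x ⬝ᵥ A *ᵥ x) :
    precondition τ P L Q lam = A := by
  have hlam : ∀ j, τ ≤ lam j := by
    intro j
    set v : Fin p → ℝ := Q *ᵥ Pi.single j 1 with hv
    set y : Fin p → ℝ := (L⁻¹)ᵀ *ᵥ v with hy
    set z : Fin p → ℝ := Pᵀ *ᵥ y with hz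
    have hvy : v = Lᵀ *ᵥ y := by
      rw [hy, Matrix.mulVec_mulVec, ← Matrix.transpose_mul,
        mul_eq_one_comm.1 hlbl.mul_inv, Matrix.transpose_one, Matrix.one_mulVec]
    have hvv : v ⬝ᵥ v = 1 := by
      rw [hv, Matrix.dotProduct_mulVec, ← Matrix.mulVec_transpose, Matrix.mulVec_mulVec,
        heig.transpose_mul, Matrix.one_mulVec]
      simp
    have hvB : v ⬝ᵥ B *ᵥ v = lam j := by
      rw [hv, heig.factor, ← Matrix.mulVec_mulVec, ← Matrix.mulVec_mulVec, Matrix.mulVec_mulVec _ Qᵀ,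
        heig.transpose_mul, Matrix.one_mulVec, Matrix.dotProduct_mulVec, ← Matrix.mulVec_transpose,
        Matrix.mulVec_mulVec, heig.transpose_mul, Matrix.one_mulVec]
      simp
    have hzz : z ⬝ᵥ z = y ⬝ᵥ y := by
      rw [hz, Matrix.dotProduct_mulVec, ← Matrix.mulVec_transpose, Matrix.mulVec_mulVec,
        Matrix.transpose_transpose, hlbl.permMul, Matrix.one_mulVec]
    have hzA : z ⬝ᵥ A *ᵥ z = lam j := by
      have h1 := transpose_mulVec_dotProduct P A y
      have h2 := transpose_mulVec_dotProduct L B y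
      rw [← hz, hlbl.factor] at h1
      rw [← hvy, hvB] at h2
      rw [h1, h2]
    -- Moving `L` to the other side, `1 = v · Lᵀ y = L v · y ≤ σ ‖y‖`, so no bound on the transpose
    -- or the inverse of `L` is needed.
    have hy1 : 1 ≤ σ ^ 2 * (z ⬝ᵥ z) := by
      have h1 : v ⬝ᵥ v = (L *ᵥ v) ⬝ᵥ y := by
        calc v ⬝ᵥ v = v ⬝ᵥ Lᵀ *ᵥ y := by rw [← hvy]
          _ = _ := by rw [Matrix.dotProduct_mulVec, Matrix.vecMul_transpose]
      have h2 : (L *ᵥ v) ⬝ᵥ y ≤ ‖(WithLp.toLp 2 (L *ᵥ v) : Vec p)‖ * ‖(WithLp.toLp 2 y : Vec p)‖ := by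
        have := real_inner_le_norm (WithLp.toLp 2 y : Vec p) (WithLp.toLp 2 (L *ᵥ v))
        rw [mul_comm]
        simpa [EuclideanSpace.inner_eq_star_dotProduct] using this
      have h3 : ‖(WithLp.toLp 2 v : Vec p)‖ = 1 := by
        rw [← sq_eq_sq₀ (norm_nonneg _) zero_le_one, norm_toLp_sq, hvv, one_pow]
      have h4 := norm_mulVec_le L v
      rw [h3, mul_one] at h4
      have h5 : 1 ≤ σ * ‖(WithLp.toLp 2 y : Vec p)‖ := by
        rw [← hvv, h1]
        exact h2.trans (mul_le_mul_of_nonneg_right (h4.trans hL) (norm_nonneg _))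
      rw [hzz, ← norm_toLp_sq, ← mul_pow]
      exact one_le_pow₀ h5
    calc τ ≤ κ / σ ^ 2 := hτκ
      _ ≤ κ * (z ⬝ᵥ z) := by
        rw [div_le_iff₀ (by positivity)]
        nlinarith
      _ ≤ lam j := hzA ▸ hA z
  have hmax : (fun j => max τ |lam j|) = lam := by
    funext j
    rw [abs_of_nonneg (hτ.trans (hlam j)), max_eq_right (hlam j)]
  calc precondition τ P L Q lam
      = Pᵀ * (L * (Q * Matrix.diagonal lam * Qᵀ) * Lᵀ) * P := by
        rw [precondition, hmax]; simp only [mul_assoc]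
    _ = Pᵀ * (P * A * Pᵀ) * P := by rw [← heig.factor, hlbl.factor]
    _ = (Pᵀ * P) * A * (Pᵀ * P) := by simp only [mul_assoc]
    _ = A := by rw [hlbl.permMul', one_mul, mul_one]

theorem abs_mul_apply_le {A B : Mat p} {α β : ℝ} (hα : 0 ≤ α) (hA : ∀ i j, |A i j| ≤ α)
    (hB : ∀ i j, |B i j| ≤ β) (i j : Fin p) : |(A * B) i j| ≤ p * (α * β) := by
  rw [Matrix.mul_apply]
  refine (Finset.abs_sum_le_sum_abs _ _).trans ?_
  refine (Finset.sum_le_card_nsmul _ _ (α * β) fun k _ => ?_).trans (by simp)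
  rw [abs_mul]
  exact mul_le_mul (hA i k) (hB k j) (abs_nonneg _) hα

theorem abs_apply_le_sigmaMax (L : Mat p) (i j : Fin p) : |L i j| ≤ sigmaMax L := by
  have h := norm_mulVec_le L (Pi.single j 1)
  have h1 : ‖(WithLp.toLp 2 (Pi.single j (1 : ℝ)) : Vec p)‖ = 1 := by
    rw [← sq_eq_sq₀ (norm_nonneg _) zero_le_one, norm_toLp_sq]; simp
  rw [h1, mul_one] at h
  refine le_trans ?_ h
  have h2 := PiLp.norm_apply_le (WithLp.toLp 2 (L *ᵥ Pi.single j 1) : Vec p) i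
  simpa using h2

/-- With determinant one the inverse is the adjugate, whose entries are determinants of `L` with one
row replaced by a unit vector; hence the `max σ 1`. -/
theorem abs_inv_apply_le {L : Mat p} {σ : ℝ} (hdet : L.det = 1) (h : ∀ i j, |L i j| ≤ σ)
    (i j : Fin p) : |L⁻¹ i j| ≤ p.factorial * max σ 1 ^ p := by
  rw [Matrix.inv_def, hdet, Ring.inverse_one, one_smul, Matrix.adjugate_apply]
  have := Matrix.det_le (A := L.updateRow j (Pi.single i 1)) (abv := AbsoluteValue.abs)
    (x := max σ 1) fun a b => by
      rw [AbsoluteValue.abs_apply, Matrix.updateRow_apply]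
      split_ifs
      · refine le_trans ?_ (le_max_right σ 1)
        by_cases hb : b = i <;> simp [hb]
      · exact (h a b).trans (le_max_left _ _)
  simpa using this

theorem exists_abs_inv_precondition_le (p : ℕ) {τ : ℝ} (hτ : 0 < τ) (σ : ℝ) :
    ∃ C : ℝ, 0 ≤ C ∧ ∀ (A P L B Q : Mat p) (lam : Fin p → ℝ), IsLBL A P L B →
      IsEigenDecomposition B Q lam → sigmaMax L ≤ σ →
      ∀ i j, |(precondition τ P L Q lam)⁻¹ i j| ≤ C := by
  set b : ℝ := p.factorial * max σ 1 ^ p with hb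
  have hb0 : 0 ≤ b := by positivity
  -- One factor `p` per product in `Pᵀ L⁻ᵀ Q D Qᵀ L⁻¹ P`, nested as the products associate.
  refine ⟨p * ((p * ((p * ((p * ((p * ((p * (1 * b)) * 1)) * τ⁻¹)) * 1)) * b)) * 1), by positivity,
    fun A P L B Q lam hlbl heig hL => ?_⟩
  set D : Mat p := Matrix.diagonal fun j => (max τ |lam j|)⁻¹ with hD
  have hpos : ∀ j, 0 < max τ |lam j| := fun j => hτ.trans_le (le_max_left _ _)
  have hDD : Matrix.diagonal (fun j => max τ |lam j|) * D = 1 := by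
    rw [hD, Matrix.diagonal_mul_diagonal, ← Matrix.diagonal_one]
    congr 1
    funext j
    exact mul_inv_cancel₀ (hpos j).ne'
  have hLT : Lᵀ * (L⁻¹)ᵀ = 1 := by
    rw [← Matrix.transpose_mul, mul_eq_one_comm.1 hlbl.mul_inv, Matrix.transpose_one]
  have hinv : (precondition τ P L Q lam)⁻¹ = Pᵀ * (L⁻¹)ᵀ * Q * D * Qᵀ * L⁻¹ * P := by
    refine Matrix.inv_eq_right_inv ?_
    calc precondition τ P L Q lam * (Pᵀ * (L⁻¹)ᵀ * Q * D * Qᵀ * L⁻¹ * P)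
        = Pᵀ * (L * (Q * (Matrix.diagonal (fun j => max τ |lam j|) * (Qᵀ * (Lᵀ * (P * Pᵀ) * (L⁻¹)ᵀ)
          * Q) * D) * Qᵀ) * L⁻¹) * P := by
          rw [precondition]; simp only [mul_assoc]
      _ = 1 := by
        rw [hlbl.permMul, mul_one, hLT, mul_one, heig.transpose_mul, mul_one, hDD, mul_one,
          heig.mul_transpose, mul_one, hlbl.mul_inv, mul_one, hlbl.permMul']
  have hP : ∀ i j, |P i j| ≤ 1 := fun i j => by
    have hPm : P ∈ Matrix.unitaryGroup (Fin p) ℝ := by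
      rw [Matrix.mem_unitaryGroup_iff, Matrix.star_eq_conjTranspose,
        Matrix.conjTranspose_eq_transpose_of_trivial]
      exact hlbl.permMul
    simpa using entry_norm_bound_of_unitary hPm i j
  have hQ : ∀ i j, |Q i j| ≤ 1 := fun i j => by
    simpa using entry_norm_bound_of_unitary (𝕜 := ℝ) heig.1 i j
  have hLi := abs_inv_apply_le hlbl.det_eq_one fun i j => (abs_apply_le_sigmaMax L i j).trans hL
  have hDb : ∀ i j, |D i j| ≤ τ⁻¹ := fun i j => by
    rw [hD, Matrix.diagonal_apply]
    split_ifs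
    · rw [abs_inv, abs_of_pos (hpos i)]
      exact inv_anti₀ hτ (le_max_left _ _)
    · simpa using hτ.le
  rw [hinv]
  refine abs_mul_apply_le (by positivity) ?_ hP
  refine abs_mul_apply_le (by positivity) ?_ hLi
  refine abs_mul_apply_le (by positivity) ?_ fun i j => hQ j i
  refine abs_mul_apply_le (by positivity) ?_ hDb
  refine abs_mul_apply_le (by positivity) ?_ hQ
  exact abs_mul_apply_le zero_le_one (fun i j => hP j i) fun i j => hLi j i

/-- Since `|x i * x j| ≤ x ⬝ᵥ x`, the quadratic form changes by at most the sum of the entrywise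
errors times `x ⬝ᵥ x`, uniformly in `x`. -/
theorem eventually_le_dotProduct_mulVec {A : ℕ → Mat p} {A₀ : Mat p} (h₀ : A₀.IsHermitian)
    (hlim : ∀ i j, Tendsto (fun k => A k i j) atTop (𝓝 (A₀ i j))) {κ : ℝ} (hκ : κ < lambdaMin h₀) :
    ∀ᶠ k in atTop, ∀ x : Fin p → ℝ, κ * (x ⬝ᵥ x) ≤ x ⬝ᵥ A k *ᵥ x := by
  have h1 : Tendsto (fun k => ∑ i, ∑ j, |A k i j - A₀ i j|) atTop (𝓝 0) := by
    have : Tendsto (fun k => ∑ i, ∑ j, |A k i j - A₀ i j|) atTop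
        (𝓝 (∑ i : Fin p, ∑ j : Fin p, |A₀ i j - A₀ i j|)) :=
      tendsto_finsetSum _ fun i _ => tendsto_finsetSum _ fun j _ =>
        ((hlim i j).sub_const _).abs
    simpa using this
  filter_upwards [h1.eventually (gt_mem_nhds (sub_pos.2 hκ))] with k hk x
  have hentry : ∀ i, x i ^ 2 ≤ x ⬝ᵥ x := fun i => by
    rw [pow_two]
    exact Finset.single_le_sum (f := fun i => x i * x i) (fun j _ => mul_self_nonneg _)
      (Finset.mem_univ i)
  have hxx : 0 ≤ x ⬝ᵥ x := Finset.sum_nonneg fun i _ => mul_self_nonneg _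
  have h2 : x ⬝ᵥ A₀ *ᵥ x - x ⬝ᵥ A k *ᵥ x ≤ (∑ i, ∑ j, |A k i j - A₀ i j|) * (x ⬝ᵥ x) := by
    rw [← dotProduct_sub, ← Matrix.sub_mulVec]
    -- Keeps the right-hand `x ⬝ᵥ x` atomic while the quadratic form is expanded.
    generalize hD : x ⬝ᵥ x = D at hentry ⊢
    simp only [dotProduct, Matrix.mulVec, Finset.sum_mul, Finset.mul_sum]
    refine Finset.sum_le_sum fun i _ => Finset.sum_le_sum fun j _ => ?_
    have hij : |x i * x j| ≤ D := by
      rw [abs_le]; constructor <;> nlinarith [hentry i, hentry j, sq_nonneg (x i + x j),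
        sq_nonneg (x i - x j)]
    calc x i * ((A₀ - A k) i j * x j) ≤ |x i * ((A₀ - A k) i j * x j)| := le_abs_self _
      _ = |A k i j - A₀ i j| * |x i * x j| := by
        rw [Matrix.sub_apply, abs_sub_comm (A k i j), ← abs_mul]; congr 1; ring
      _ ≤ _ := mul_le_mul_of_nonneg_left hij (abs_nonneg _)
  have h3 := lambdaMin_mul_dotProduct_le h₀ x
  nlinarith [mul_le_mul_of_nonneg_right hk.le hxx]

theorem measurable_inv_apply {Ω : Type*} {m : MeasurableSpace Ω} {A : Ω → Mat p}
    (hA : ∀ i j, Measurable fun ω => A ω i j) (i j : Fin p) :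
    Measurable fun ω => (A ω)⁻¹ i j := by
  have hdet : ∀ M : Ω → Mat p, (∀ i j, Measurable fun ω => M ω i j) →
      Measurable fun ω => (M ω).det := fun M hM => by
    simp only [Matrix.det_apply']
    exact Finset.measurable_sum _ fun s _ => (Finset.measurable_prod _ fun i _ => hM _ _).const_mul _
  simp only [Matrix.inv_def, Matrix.smul_apply, smul_eq_mul, Ring.inverse_eq_inv,
    Matrix.adjugate_apply]
  refine (hdet A hA).inv.mul (hdet _ fun a b => ?_)
  simp only [Matrix.updateRow_apply]
  split_ifs
  · exact measurable_const
  · exact hA a b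

end LinearAlgebra

/-! ### Second order expansions -/

section Calculus

variable {p : ℕ} {loss : Vec p → ℝ}

theorem fderiv_fderiv_apply (x u v : Vec p) :
    fderiv ℝ (fderiv ℝ loss) x u v = ∑ l, ∑ m, u l * v m * hessian loss x l m := by
  have hu : ∀ u : Vec p, u = ∑ l, u l • EuclideanSpace.single l (1 : ℝ) := fun u => by
    ext i; simp [Pi.single_apply]
  conv_lhs => rw [hu u, hu v]
  simp only [map_sum, map_smul, _root_.sum_apply, _root_.smul_apply,
    smul_eq_mul, hessian, Matrix.of_apply, Finset.mul_sum]
  rw [Finset.sum_comm]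
  exact Finset.sum_congr rfl fun l _ => Finset.sum_congr rfl fun m _ => by ring

/-- Strict differentiability of a C¹ map. Both points may move, so symmetric differences around a
moving iterate can be expanded at the fixed `x₀` without a third derivative. -/
theorem exists_fderiv_sub_le (hloss : ContDiff ℝ 2 loss) (x₀ : Vec p) {ε : ℝ} (hε : 0 < ε) :
    ∃ δ : ℝ, 0 < δ ∧ ∀ x y : Vec p, ‖x - x₀‖ < δ → ‖y - x₀‖ < δ →
      ‖fderiv ℝ loss x - fderiv ℝ loss y - fderiv ℝ (fderiv ℝ loss) x₀ (x - y)‖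
        ≤ ε * ‖x - y‖ := by
  have h1 : ContDiff ℝ 1 (fderiv ℝ loss) := hloss.fderiv_right (by norm_num)
  have h2 := (h1.contDiffAt (x := x₀)).hasStrictFDerivAt one_ne_zero
  have h3 := h2.isLittleO.def hε
  obtain ⟨δ, hδ, h⟩ := Metric.eventually_nhds_iff.1 h3
  refine ⟨δ, hδ, fun x y hx hy => @h (x, y) ?_⟩
  rw [Prod.dist_eq, max_lt_iff, dist_eq_norm, dist_eq_norm]
  exact ⟨hx, hy⟩

theorem exists_gradient_diff_le (hloss : ContDiff ℝ 2 loss) (x₀ : Vec p) {ε : ℝ} (hε : 0 < ε) :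
    ∃ δ : ℝ, 0 < δ ∧ ∀ (x Δ : Vec p) (c : ℝ), 0 < c → ‖x - x₀‖ + c * ‖Δ‖ < δ → ∀ i,
      |gradient loss (x + c • Δ) i - gradient loss (x - c • Δ) i
          - 2 * c * ∑ l, Δ l * hessian loss x₀ l i| ≤ ε * (2 * c * ‖Δ‖) := by
  obtain ⟨δ, hδ, h⟩ := exists_fderiv_sub_le hloss x₀ hε
  refine ⟨δ, hδ, fun x Δ c hc hx i => ?_⟩
  have hg : ∀ z i, gradient loss z i = fderiv ℝ loss z (EuclideanSpace.single i 1) := by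
    intro z i
    rw [← inner_gradient_left, EuclideanSpace.inner_single_right]
    simp
  have hn : ‖c • Δ‖ = c * ‖Δ‖ := by rw [norm_smul, Real.norm_of_nonneg hc.le]
  have e1 : ‖x + c • Δ - x₀‖ < δ := by
    rw [add_sub_right_comm]
    exact (norm_add_le _ _).trans_lt (by rwa [hn])
  have e2 : ‖x - c • Δ - x₀‖ < δ := by
    rw [sub_right_comm]
    exact (norm_sub_le _ _).trans_lt (by rwa [hn])
  have e3 : x + c • Δ - (x - c • Δ) = (2 * c) • Δ := by
    rw [add_sub_sub_cancel, ← add_smul, two_mul]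
  have h0 := h _ _ e1 e2
  rw [e3] at h0
  have h4 := ContinuousLinearMap.le_of_opNorm_le _ h0 (EuclideanSpace.single i (1 : ℝ))
  have e4 : fderiv ℝ (fderiv ℝ loss) x₀ Δ (EuclideanSpace.single i 1)
      = ∑ l, Δ l * hessian loss x₀ l i := by
    rw [fderiv_fderiv_apply]
    refine Finset.sum_congr rfl fun l _ => ?_
    rw [Finset.sum_eq_single i] <;> simp +contextual
  simp only [_root_.sub_apply, map_smul, _root_.smul_apply, e4,
    smul_eq_mul, ← hg, PiLp.norm_single, norm_one, mul_one, norm_smul, norm_mul,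
    Real.norm_eq_abs, abs_of_pos hc, abs_two] at h4
  exact h4

/-- The mean value inequality for `z ↦ loss (z + c' Δ') - loss z` between `x - cΔ` and `x + cΔ`: its
derivative is close to the second derivative at `x₀` applied to `c' Δ'`. -/
theorem exists_double_diff_le (hloss : ContDiff ℝ 2 loss) (x₀ : Vec p) {ε : ℝ} (hε : 0 < ε) :
    ∃ δ : ℝ, 0 < δ ∧ ∀ (x Δ Δ' : Vec p) (c c' : ℝ), 0 < c → 0 < c' →
      ‖x - x₀‖ + c * ‖Δ‖ + c' * ‖Δ'‖ < δ →
      |(loss (x + c • Δ + c' • Δ') - loss (x + c • Δ))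
          - (loss (x - c • Δ + c' • Δ') - loss (x - c • Δ))
          - 2 * c * c' * ∑ l, ∑ m, Δ' l * Δ m * hessian loss x₀ l m|
        ≤ ε * (2 * c * c' * (‖Δ‖ * ‖Δ'‖)) := by
  obtain ⟨δ, hδ, h⟩ := exists_fderiv_sub_le hloss x₀ hε
  refine ⟨δ, hδ, fun x Δ Δ' c c' hc hc' hx => ?_⟩
  have hn : ‖c • Δ‖ = c * ‖Δ‖ := by rw [norm_smul, Real.norm_of_nonneg hc.le]
  have hn' : ‖c' • Δ'‖ = c' * ‖Δ'‖ := by rw [norm_smul, Real.norm_of_nonneg hc'.le]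
  have hdiff : Differentiable ℝ loss := hloss.differentiable (by norm_num)
  -- The radius is reduced so that both `z` and `z + c' • Δ'` stay within `δ` of `x₀`.
  set s : Set (Vec p) := Metric.ball x₀ (δ - c' * ‖Δ'‖) with hs
  have hmem : ∀ z, z ∈ s ↔ ‖z - x₀‖ < δ - c' * ‖Δ'‖ := fun z => by
    rw [hs, Metric.mem_ball, dist_eq_norm]
  have e1 : x + c • Δ ∈ s := by
    rw [hmem, add_sub_right_comm]
    exact (norm_add_le _ _).trans_lt (by rw [hn]; linarith)
  have e2 : x - c • Δ ∈ s := by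
    rw [hmem, sub_right_comm]
    exact (norm_sub_le _ _).trans_lt (by rw [hn]; linarith)
  have e3 : x + c • Δ - (x - c • Δ) = (2 * c) • Δ := by
    rw [add_sub_sub_cancel, ← add_smul, two_mul]
  have key := (convex_ball x₀ (δ - c' * ‖Δ'‖)).norm_image_sub_le_of_norm_hasFDerivWithin_le'
    (𝕜 := ℝ) (f := fun z => loss (z + c' • Δ') - loss z)
    (f' := fun z => fderiv ℝ loss (z + c' • Δ') - fderiv ℝ loss z)
    (φ := fderiv ℝ (fderiv ℝ loss) x₀ (c' • Δ')) (C := ε * ‖c' • Δ'‖)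
    (fun z _ => ?_) (fun z hz => ?_) e2 e1
  · have e5 : ‖(2 * c) • Δ‖ = 2 * c * ‖Δ‖ := by
      rw [norm_smul, Real.norm_of_nonneg (by positivity)]
    rw [e3, fderiv_fderiv_apply, e5, hn', Real.norm_eq_abs] at key
    have e4 : ∑ l, ∑ m, (c' • Δ') l * ((2 * c) • Δ) m * hessian loss x₀ l m
        = 2 * c * c' * ∑ l, ∑ m, Δ' l * Δ m * hessian loss x₀ l m := by
      simp only [Finset.mul_sum, PiLp.smul_apply, smul_eq_mul]
      exact Finset.sum_congr rfl fun l _ => Finset.sum_congr rfl fun m _ => by ring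
    rw [e4] at key
    refine key.trans (le_of_eq ?_)
    ring
  · have h1 := (hdiff (z + c' • Δ')).hasFDerivAt.comp z ((hasFDerivAt_id z).add_const (c' • Δ'))
    exact (h1.sub (hdiff z).hasFDerivAt).hasFDerivWithinAt
  · have hz' := (hmem z).1 hz
    have := h (z + c' • Δ') z ?_ ?_
    · simpa using this
    · rw [add_sub_right_comm]
      exact (norm_add_le _ _).trans_lt (by rw [hn']; linarith)
    · have : 0 ≤ c' * ‖Δ'‖ := by positivity
      linarith

end Calculus

/-! ### Almost sure convergence of series of martingale differences -/

section Probability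

variable {Ω : Type*} {mΩ : MeasurableSpace Ω} {μ : Measure Ω}

/-- By the law of total variance, the left side is at most the variance. -/
theorem integral_sub_condExp_sq_le [IsProbabilityMeasure μ] {m : MeasurableSpace Ω} (hm : m ≤ mΩ)
    {X : Ω → ℝ} (hX : MemLp X 2 μ) :
    ∫ ω, (X ω - (μ[X | m]) ω) ^ 2 ∂μ ≤ ∫ ω, X ω ^ 2 ∂μ := by
  have h1 := integral_condVar_add_variance_condExp hm hX
  have h2 : ∫ ω, (Var[X; μ | m]) ω ∂μ = ∫ ω, (X ω - (μ[X | m]) ω) ^ 2 ∂μ := by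
    rw [condVar, integral_condExp hm]
    rfl
  have h3 := variance_nonneg (μ[X | m]) μ
  have h4 : Var[X; μ] ≤ ∫ ω, X ω ^ 2 ∂μ := variance_le_expectation_sq hX.1
  linarith

/-- By the tower property, centring at an intermediate `𝒢 k` still gives martingale differences for
`ℱ`. Orthogonality bounds the partial sums in L², hence in L¹, and Doob's theorem applies. The
intermediate σ-algebra can contain the perturbations of the current iteration. -/
theorem ae_seriesConverges_sub_condExp [IsProbabilityMeasure μ] (ℱ : Filtration ℕ mΩ)
    {X : ℕ → Ω → ℝ} {𝒢 : ℕ → MeasurableSpace Ω} (h𝒢 : ∀ k, ℱ k ≤ 𝒢 k)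
    (h𝒢' : ∀ k, 𝒢 k ≤ ℱ (k + 1)) (hX : ∀ k, Measurable[ℱ (k + 1)] (X k))
    (hL2 : ∀ k, MemLp (X k) 2 μ) (hs : Summable fun k => ∫ ω, X k ω ^ 2 ∂μ) :
    ∀ᵐ ω ∂μ, SeriesConverges fun k => X k ω - (μ[X k | 𝒢 k]) ω := by
  set D : ℕ → Ω → ℝ := fun k => X k - μ[X k | 𝒢 k] with hD
  have h𝒢m : ∀ k, 𝒢 k ≤ mΩ := fun k => (h𝒢' k).trans (ℱ.le _)
  have hDL2 : ∀ k, MemLp (D k) 2 μ := fun k => (hL2 k).sub ((hL2 k).condExp one_le_two)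
  have hDint : ∀ k, Integrable (D k) μ := fun k => (hDL2 k).integrable one_le_two
  have hDmeas : ∀ k, StronglyMeasurable[ℱ (k + 1)] (D k) := fun k =>
    (hX k).stronglyMeasurable.sub (stronglyMeasurable_condExp.mono (h𝒢' k))
  have hD0 : ∀ k, μ[D k | ℱ k] =ᵐ[μ] 0 := by
    intro k
    have hXi := (hL2 k).integrable one_le_two
    have h1 := condExp_sub (μ := μ) hXi (integrable_condExp (m := 𝒢 k) (f := X k)) (ℱ k)
    have h2 := condExp_condExp_of_le (μ := μ) (f := X k) (h𝒢 k) (h𝒢m k)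
    filter_upwards [h1, h2] with ω e1 e2
    rw [e1, Pi.sub_apply, e2, sub_self, Pi.zero_apply]
  set M : ℕ → Ω → ℝ := fun n => ∑ k ∈ Finset.range n, D k with hM
  have hMs : ∀ n, M (n + 1) = M n + D n := fun n => Finset.sum_range_succ _ _
  have hML2 : ∀ n, MemLp (M n) 2 μ := fun n => memLp_finsetSum' _ fun k _ => hDL2 k
  have hMmeas : StronglyAdapted ℱ M := fun n =>
    Finset.stronglyMeasurable_sum _ fun k hk =>
      (hDmeas k).mono (ℱ.mono (Finset.mem_range.1 hk))
  have hmart : Martingale M ℱ μ := by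
    refine martingale_of_condExp_sub_eq_zero_nat hMmeas
      (fun n => (hML2 n).integrable one_le_two) fun n => ?_
    rw [hMs, add_sub_cancel_left]
    exact hD0 n
  have hsq : ∀ n, ∫ ω, M n ω ^ 2 ∂μ = ∑ k ∈ Finset.range n, ∫ ω, D k ω ^ 2 ∂μ := by
    intro n
    induction n with
    | zero => simp [hM]
    | succ n ih =>
      have hprod : Integrable (M n * D n) μ := (hML2 n).integrable_mul (hDL2 n)
      -- `M n` is known at time `n`, while `D n` has conditional mean zero.
      have hcross : ∫ ω, (M n * D n) ω ∂μ = 0 := by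
        rw [← integral_condExp (ℱ.le n)]
        have h1 := condExp_mul_of_stronglyMeasurable_left (hMmeas n) hprod (hDint n)
        rw [integral_congr_ae h1]
        refine (integral_congr_ae (g := fun _ => 0) ?_).trans (by simp)
        filter_upwards [hD0 n] with ω e
        rw [Pi.mul_apply, e, Pi.zero_apply, mul_zero]
      have hsum : Integrable (fun ω => M n ω ^ 2 + 2 * (M n * D n) ω) μ :=
        (hML2 n).integrable_sq.add (hprod.const_mul 2)
      have hexp : ∀ ω, M (n + 1) ω ^ 2 = M n ω ^ 2 + 2 * (M n * D n) ω + D n ω ^ 2 := by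
        intro ω
        rw [hMs, Pi.add_apply, Pi.mul_apply]
        ring
      rw [Finset.sum_range_succ, ← ih, integral_congr_ae (Eventually.of_forall hexp),
        integral_add hsum (hDL2 n).integrable_sq,
        integral_add (hML2 n).integrable_sq (hprod.const_mul 2), integral_const_mul, hcross]
      ring
  set S : ℝ := ∑' k, ∫ ω, X k ω ^ 2 ∂μ with hS
  have hbound : ∀ n, ∫ ω, M n ω ^ 2 ∂μ ≤ S := by
    intro n
    rw [hsq]
    refine (Finset.sum_le_sum fun k _ => integral_sub_condExp_sq_le (h𝒢m k) (hL2 k)).trans ?_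
    exact hs.sum_le_tsum _ fun k _ => integral_nonneg fun ω => sq_nonneg _
  have hS0 : 0 ≤ S := tsum_nonneg fun k => integral_nonneg fun ω => sq_nonneg _
  have hL1 : ∀ n, eLpNorm (M n) 1 μ ≤ ((1 + S).toNNReal : ENNReal) := by
    intro n
    rw [eLpNorm_one_eq_lintegral_enorm,
      ← ofReal_integral_norm_eq_lintegral_enorm ((hML2 n).integrable one_le_two)]
    refine ENNReal.ofReal_le_ofReal ?_
    calc ∫ ω, ‖M n ω‖ ∂μ ≤ ∫ ω, (1 + M n ω ^ 2) ∂μ := by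
          refine integral_mono ((hML2 n).integrable one_le_two).norm
            ((integrable_const _).add (hML2 n).integrable_sq) fun ω => ?_
          simp only [Real.norm_eq_abs]
          rw [← sq_abs (M n ω)]
          nlinarith [sq_nonneg (|M n ω| - 1)]
      _ = 1 + ∫ ω, M n ω ^ 2 ∂μ := by
          rw [integral_add (integrable_const _) (hML2 n).integrable_sq]; simp
      _ ≤ 1 + S := by linarith [hbound n]
  filter_upwards [hmart.submartingale.ae_tendsto_limitProcess hL1] with ω hω
  refine ⟨_, hω.congr fun n => ?_⟩
  simp [hM, hD, Finset.sum_apply]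

theorem condExp_mul_of_condExp_sub_eq_zero [IsFiniteMeasure μ] {m : MeasurableSpace Ω}
    (hm : m ≤ mΩ) {f Z l : Ω → ℝ} (hf : Measurable[m] f) (hl : Measurable[m] l)
    (hZ : Integrable Z μ) (hN : Integrable (fun ω => Z ω - l ω) μ)
    (h0 : μ[fun ω => Z ω - l ω | m] =ᵐ[μ] 0) (hfZ : Integrable (fun ω => f ω * Z ω) μ) :
    μ[fun ω => f ω * Z ω | m] =ᵐ[μ] fun ω => f ω * l ω := by
  have hli : Integrable l μ := (hZ.sub hN).congr (Eventually.of_forall fun ω => by simp)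
  have h1 : μ[f * Z | m] =ᵐ[μ] f * μ[Z | m] :=
    condExp_mul_of_stronglyMeasurable_left hf.stronglyMeasurable hfZ hZ
  have h2 : μ[fun ω => Z ω - l ω | m] =ᵐ[μ] μ[Z | m] - μ[l | m] := condExp_sub hZ hli m
  rw [condExp_of_stronglyMeasurable hm hl.stronglyMeasurable hli] at h2
  change μ[f * Z | m] =ᵐ[μ] _
  filter_upwards [h0, h1, h2] with ω e0 e1 e2
  rw [e0, Pi.sub_apply, Pi.zero_apply] at e2
  rw [e1, Pi.mul_apply, sub_eq_zero.1 e2.symm]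

/-- Second moments are needed for the weighted measurement `f * Z` only, not for the noise: the
exact part `f * l` is the conditional mean of `f * Z`. -/
theorem ae_seriesConverges_noise [IsProbabilityMeasure μ] (ℱ : Filtration ℕ mΩ)
    {𝒢 : ℕ → MeasurableSpace Ω} (h𝒢 : ∀ k, ℱ k ≤ 𝒢 k) (h𝒢' : ∀ k, 𝒢 k ≤ ℱ (k + 1))
    {f Z l : ℕ → Ω → ℝ} (hf : ∀ k, Measurable[𝒢 k] (f k)) (hl : ∀ k, Measurable[𝒢 k] (l k))
    (hZm : ∀ k, Measurable[ℱ (k + 1)] (Z k)) (hZ : ∀ k, Integrable (Z k) μ)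
    (hN : ∀ k, Integrable (fun ω => Z k ω - l k ω) μ)
    (h0 : ∀ k, μ[fun ω => Z k ω - l k ω | 𝒢 k] =ᵐ[μ] 0)
    (hL2 : ∀ k, MemLp (fun ω => f k ω * Z k ω) 2 μ)
    (hs : Summable fun k => ∫ ω, (f k ω * Z k ω) ^ 2 ∂μ) :
    ∀ᵐ ω ∂μ, SeriesConverges fun k => f k ω * (Z k ω - l k ω) := by
  have h1 := ae_seriesConverges_sub_condExp (μ := μ) ℱ h𝒢 h𝒢' (X := fun k ω => f k ω * Z k ω)
    (fun k => ((hf k).mono (h𝒢' k) le_rfl).mul (hZm k)) hL2 hs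
  have h2 : ∀ᵐ ω ∂μ, ∀ k, (μ[fun ω => f k ω * Z k ω | 𝒢 k]) ω = f k ω * l k ω :=
    ae_all_iff.2 fun k => condExp_mul_of_condExp_sub_eq_zero ((h𝒢' k).trans (ℱ.le _)) (hf k) (hl k)
      (hZ k) (hN k) (h0 k) ((hL2 k).integrable one_le_two)
  filter_upwards [h1, h2] with ω e1 e2
  simpa only [e2, mul_sub] using e1

/-- Independence of the past turns the conditional mean into the plain mean. -/
theorem ae_seriesConverges_indep [IsProbabilityMeasure μ] (ℱ : Filtration ℕ mΩ)
    {m : ℕ → MeasurableSpace Ω} (hm : ∀ k, m k ≤ ℱ (k + 1)) (hind : ∀ k, Indep (m k) (ℱ k) μ)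
    {Y : ℕ → Ω → ℝ} (hY : ∀ k, Measurable[m k] (Y k)) (hL2 : ∀ k, MemLp (Y k) 2 μ) {C : ℝ}
    (hC : ∀ k, ∫ ω, Y k ω ^ 2 ∂μ ≤ C) {b : ℕ → ℝ} (hb : Summable fun k => b k ^ 2) :
    ∀ᵐ ω ∂μ, SeriesConverges fun k => b k * (Y k ω - ∫ ω', Y k ω' ∂μ) := by
  have h1 := ae_seriesConverges_sub_condExp (μ := μ) ℱ (X := fun k ω => b k * Y k ω)
    (fun k => le_rfl) (fun k => ℱ.mono k.le_succ)
    (fun k => ((hY k).mono (hm k) le_rfl).const_mul (b k)) (fun k => (hL2 k).const_mul (b k)) ?_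
  · have h2 : ∀ᵐ ω ∂μ, ∀ k, (μ[fun ω => b k * Y k ω | ℱ k]) ω = b k * ∫ ω', Y k ω' ∂μ := by
      refine ae_all_iff.2 fun k => ?_
      have := condExp_indep_eq (μ := μ) ((hm k).trans (ℱ.le _)) (ℱ.le k)
        ((hY k).const_mul (b k)).stronglyMeasurable (hind k)
      filter_upwards [this] with ω e
      rw [e, integral_const_mul]
    filter_upwards [h1, h2] with ω e1 e2
    simpa only [e2, mul_sub] using e1
  · refine (hb.mul_right C).of_nonneg_of_le (fun k => integral_nonneg fun ω => sq_nonneg _)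
      fun k => ?_
    simp only [mul_pow, integral_const_mul]
    exact mul_le_mul_of_nonneg_left (hC k) (sq_nonneg _)

theorem ae_summable_of_summable_integral {X : ℕ → Ω → ℝ} (h0 : ∀ k ω, 0 ≤ X k ω)
    (hX : ∀ k, Integrable (X k) μ) (hs : Summable fun k => ∫ ω, X k ω ∂μ) :
    ∀ᵐ ω ∂μ, Summable fun k => X k ω := by
  have h1 : ∫⁻ ω, ∑' k, ENNReal.ofReal (X k ω) ∂μ ≠ ⊤ := by
    rw [lintegral_tsum fun k => (hX k).1.aemeasurable.ennreal_ofReal]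
    simp_rw [← fun k => ofReal_integral_eq_lintegral_ofReal (hX k) (Eventually.of_forall (h0 k))]
    exact hs.tsum_ofReal_ne_top
  have h2 := ae_lt_top' (AEMeasurable.tsum
    fun k => (hX k).1.aemeasurable.ennreal_ofReal) h1
  filter_upwards [h2] with ω hω
  have := ENNReal.summable_toReal hω.ne
  simpa only [ENNReal.toReal_ofReal (h0 _ ω)] using this

/-! ### Second moments -/

theorem memLp_and_integral_sq_le {f : Ω → ℝ} {ρ : ℝ} (hf : AEStronglyMeasurable f μ)
    (h : eLpNorm f 2 μ ≤ ENNReal.ofReal ρ) : MemLp f 2 μ ∧ ∫ ω, f ω ^ 2 ∂μ ≤ ρ ^ 2 := by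
  have hm : MemLp f 2 μ := ⟨hf, h.trans_lt ENNReal.ofReal_lt_top⟩
  refine ⟨hm, ?_⟩
  have h1 := hm.eLpNorm_eq_integral_rpow_norm two_ne_zero ENNReal.ofNat_ne_top
  rw [h1] at h
  set I : ℝ := ∫ ω, f ω ^ 2 ∂μ with hI
  have hI0 : 0 ≤ I := integral_nonneg fun ω => sq_nonneg _
  have h2 : ∫ ω, ‖f ω‖ ^ (2 : ENNReal).toReal ∂μ = I := by
    simp [hI]
  rw [h2, ENNReal.toReal_ofNat, ← one_div, ← Real.sqrt_eq_rpow] at h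
  rcases le_or_gt 0 ρ with hρ | hρ
  · rw [ENNReal.ofReal_le_ofReal_iff hρ] at h
    exact (Real.sqrt_le_left hρ).1 h
  -- For negative `ρ` the bound is `0`, which forces the integral to vanish.
  · rw [ENNReal.ofReal_of_nonpos hρ.le, nonpos_iff_eq_zero, ENNReal.ofReal_eq_zero] at h
    have := Real.sqrt_eq_zero'.1 (le_antisymm h (Real.sqrt_nonneg _))
    nlinarith

theorem integral_sub_sq_le {f g : Ω → ℝ} {S : ℝ} (hf : MemLp f 2 μ) (hg : MemLp g 2 μ)
    (hfS : ∫ ω, f ω ^ 2 ∂μ ≤ S) (hgS : ∫ ω, g ω ^ 2 ∂μ ≤ S) :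
    ∫ ω, (f ω - g ω) ^ 2 ∂μ ≤ 4 * S := by
  calc ∫ ω, (f ω - g ω) ^ 2 ∂μ ≤ ∫ ω, (2 * f ω ^ 2 + 2 * g ω ^ 2) ∂μ := by
        refine integral_mono (hf.sub hg).integrable_sq
          ((hf.integrable_sq.const_mul 2).add (hg.integrable_sq.const_mul 2)) fun ω => ?_
        nlinarith [sq_nonneg (f ω + g ω)]
    _ = 2 * (∫ ω, f ω ^ 2 ∂μ) + 2 * ∫ ω, g ω ^ 2 ∂μ := by
        rw [integral_add (hf.integrable_sq.const_mul 2) (hg.integrable_sq.const_mul 2),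
          integral_const_mul, integral_const_mul]
    _ ≤ 4 * S := by linarith

theorem memLp_mul_of_indepFun {f g : Ω → ℝ} (h : IndepFun f g μ) (hf : MemLp f 2 μ)
    (hg : MemLp g 2 μ) : MemLp (fun ω => f ω * g ω) 2 μ ∧
      ∫ ω, (f ω * g ω) ^ 2 ∂μ = (∫ ω, f ω ^ 2 ∂μ) * ∫ ω, g ω ^ 2 ∂μ := by
  have h2 : IndepFun (fun ω => f ω ^ 2) (fun ω => g ω ^ 2) μ :=
    h.comp (φ := fun x => x ^ 2) (ψ := fun x => x ^ 2) (by fun_prop) (by fun_prop)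
  constructor
  · have hfg : AEStronglyMeasurable (fun ω => f ω * g ω) μ := hf.1.mul hg.1
    rw [memLp_two_iff_integrable_sq hfg]
    simp only [mul_pow]
    exact h2.integrable_mul hf.integrable_sq hg.integrable_sq
  · simp only [mul_pow]
    exact h2.integral_fun_mul_eq_mul_integral hf.integrable_sq.1 hg.integrable_sq.1

/-! ### Moments of the perturbation components and of their ratios -/

namespace IsPerturbation

variable {ι : Type*} {ℱ : Filtration ℕ mΩ} {X : ℕ → ι → Ω → ℝ} {ρ : ℝ}

theorem measurable (h : IsPerturbation μ ℱ X ρ) (k : ℕ) (i : ι) : Measurable (X k i) :=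
  (h.meas k i).mono (ℱ.le _) le_rfl

theorem memLp [IsFiniteMeasure μ] (h : IsPerturbation μ ℱ X ρ) (k : ℕ) (i : ι) (q : ENNReal) :
    MemLp (X k i) q μ :=
  MemLp.of_bound (h.measurable k i).aestronglyMeasurable ρ (h.bdd k i)

theorem memLp_inv (h : IsPerturbation μ ℱ X ρ) (k : ℕ) (i : ι) :
    MemLp (fun ω => (X k i ω)⁻¹) 2 μ ∧ ∫ ω, ((X k i ω)⁻¹) ^ 2 ∂μ ≤ ρ ^ 2 :=
  memLp_and_integral_sq_le (h.measurable k i).inv.aestronglyMeasurable (h.inv_moment k i)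

theorem integral_eq_zero (h : IsPerturbation μ ℱ X ρ) (k : ℕ) (i : ι) :
    ∫ ω, X k i ω ∂μ = 0 := by
  have := (h.symm k i).integral_eq
  rw [integral_neg] at this
  linarith

/-- The bounded numerator is pulled out, so no independence is used and `i = j` is allowed. -/
theorem memLp_ratio (h : IsPerturbation μ ℱ X ρ) (k : ℕ) (i j : ι) :
    MemLp (fun ω => X k i ω * (X k j ω)⁻¹) 2 μ ∧
      ∫ ω, (X k i ω * (X k j ω)⁻¹) ^ 2 ∂μ ≤ ρ ^ 2 * ρ ^ 2 := by
  obtain ⟨h1, h2⟩ := h.memLp_inv k j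
  have hb : ∀ᵐ ω ∂μ, |X k i ω * (X k j ω)⁻¹| ≤ |ρ * (X k j ω)⁻¹| := by
    filter_upwards [h.bdd k i] with ω hω
    rw [abs_mul, abs_mul]
    exact mul_le_mul_of_nonneg_right (hω.trans (le_abs_self _)) (abs_nonneg _)
  have hm : MemLp (fun ω => X k i ω * (X k j ω)⁻¹) 2 μ :=
    (h1.const_mul ρ).mono ((h.measurable k i).mul (h.measurable k j).inv).aestronglyMeasurable hb
  refine ⟨hm, ?_⟩
  calc ∫ ω, (X k i ω * (X k j ω)⁻¹) ^ 2 ∂μ ≤ ∫ ω, (ρ * (X k j ω)⁻¹) ^ 2 ∂μ := by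
        refine integral_mono_ae hm.integrable_sq (h1.const_mul ρ).integrable_sq ?_
        filter_upwards [hb] with ω hω
        exact sq_le_sq.2 hω
    _ = ρ ^ 2 * ∫ ω, ((X k j ω)⁻¹) ^ 2 ∂μ := by simp only [mul_pow, integral_const_mul]
    _ ≤ ρ ^ 2 * ρ ^ 2 := mul_le_mul_of_nonneg_left h2 (sq_nonneg _)

/-- Off the diagonal, independence leaves the factor `∫ X k i`, which is zero by symmetry. This is
how multiplying by reciprocals selects a single Hessian entry. -/
theorem integral_ratio [IsProbabilityMeasure μ] [DecidableEq ι] (h : IsPerturbation μ ℱ X ρ)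
    (k : ℕ) (i j : ι) : ∫ ω, X k i ω * (X k j ω)⁻¹ ∂μ = if i = j then 1 else 0 := by
  split_ifs with hij
  · subst hij
    rw [integral_congr_ae (g := fun _ => (1 : ℝ))]
    · simp
    · filter_upwards [h.ne_zero k i] with ω hω
      exact mul_inv_cancel₀ hω
  · have hI : IndepFun (X k i) (fun ω => (X k j ω)⁻¹) μ :=
      ((h.indep k).indepFun hij).comp (φ := id) (ψ := fun x => x⁻¹) measurable_id measurable_inv
    rw [hI.integral_fun_mul_eq_mul_integral (h.measurable k i).aestronglyMeasurable
      (h.measurable k j).inv.aestronglyMeasurable, h.integral_eq_zero, zero_mul]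

theorem measurable_comap (X : ℕ → ι → Ω → ℝ) (k : ℕ) (i : ι) :
    Measurable[MeasurableSpace.comap (fun ω i => X k i ω) inferInstance] (X k i) :=
  (measurable_pi_apply i).comp (comap_measurable (fun ω i => X k i ω))

theorem comap_le (h : IsPerturbation μ ℱ X ρ) (k : ℕ) :
    MeasurableSpace.comap (fun ω i => X k i ω) inferInstance ≤ ℱ (k + 1) :=
  Measurable.comap_le (@measurable_pi_lambda _ _ _ (ℱ (k + 1)) _ _ fun i => h.meas k i)

end IsPerturbation

end Probability

/-! ### Sample path consequences of the recursions -/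

section Run

variable {Ω : Type*} {p : ℕ} {R : Run Ω p} {g : Gains} {τ σ : ℝ} {θ₀ : Vec p} {H₀ : Mat p}

theorem Gains.Admissible.isWeight (hg : g.Admissible) : IsWeight g.w :=
  ⟨hg.w_pos, hg.w_le_one, hg.w_sum⟩

theorem Run.Follows.tendsto_hbar (hR : R.Follows g τ θ₀ H₀) {H : Mat p} (hH : H.IsHermitian)
    {ω : Ω} (h : ∀ i j, AveragesToZero g.w
      fun k => R.δG k ω i / (2 * g.c k) * (R.Δ k ω j)⁻¹ - H i j) (i j : Fin p) :
    Tendsto (fun k => R.Hbar k ω i j) atTop (𝓝 (H i j)) := by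
  have hsymm : H j i = H i j := by simpa using hH.apply i j
  have h1 := ((h i j).const_mul (1 / 2)).add ((h j i).const_mul (1 / 2))
  -- Shifted by one: `Hbar 0` already contains the update with weight `w 0`, so the averaging starts
  -- from `H₀`.
  have h2 := h1 (fun k => match k with
    | 0 => H₀ i j - H i j
    | k + 1 => R.Hbar k ω i j - H i j) fun k => by
      rcases k with _ | k
      · simp only [hR.hbar_zero, hessEstimate, recip, Matrix.add_apply, Matrix.smul_apply,
          Matrix.transpose_apply, Matrix.of_apply, smul_eq_mul, hsymm]
        ring
      · simp only [hR.hbar_succ, hessEstimate, recip, Matrix.add_apply, Matrix.smul_apply,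
          Matrix.transpose_apply, Matrix.of_apply, smul_eq_mul, hsymm]
        ring
  have h3 := (tendsto_add_atTop_iff_nat 1).2 h2
  simpa using h3.add_const (H i j)

/-- The factor `2` in the bound on `τ` is the room for approximation: eventually half of the least
eigenvalue survives. -/
theorem Run.Follows.eventually_Hbb_eq [NeZero p] (hR : R.Follows g τ θ₀ H₀) (hσ : 0 < σ)
    (hτ : 0 ≤ τ) (hL : ∀ k ω, sigmaMax (R.L k ω) ≤ σ) {H : Mat p} (hH : H.PosDef)
    (hτle : τ ≤ lambdaMin hH.isHermitian / (2 * σ ^ 2)) {ω : Ω}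
    (hlim : ∀ i j, Tendsto (fun k => R.Hbar k ω i j) atTop (𝓝 (H i j))) :
    ∃ K₁ : ℕ, ∀ k : ℕ, K₁ < k → R.Hbb τ k ω = R.Hbar k ω := by
  have hpos := lambdaMin_pos hH
  have h := eventually_le_dotProduct_mulVec hH.isHermitian hlim (half_lt_self hpos)
  obtain ⟨K, hK⟩ := eventually_atTop.1 h
  refine ⟨K, fun k hk => precondition_eq (hR.lbl k ω) (hR.eigen k ω) hσ (hL k ω) (half_pos hpos).le
    hτ (hτle.trans_eq ?_) (hK k hk.le)⟩
  rw [div_div]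

theorem Run.dir_apply (R : Run Ω p) (τ : ℝ) (k : ℕ) (ω : Ω) (i : Fin p) :
    R.dir τ k ω i = ∑ j, (R.Hbb τ k ω)⁻¹ i j * R.G k ω j := rfl

theorem norm_sq_dir_le {C : ℝ} {k : ℕ} {ω : Ω} (hC : ∀ i j, |(R.Hbb τ k ω)⁻¹ i j| ≤ C) :
    ‖R.dir τ k ω‖ ^ 2 ≤ p ^ 2 * C ^ 2 * ∑ i, R.G k ω i ^ 2 := by
  have h1 : ∀ i, R.dir τ k ω i ^ 2 ≤ p * (C ^ 2 * ∑ j, R.G k ω j ^ 2) := by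
    intro i
    rw [Run.dir_apply]
    refine sq_sum_le_card_mul_sum_sq.trans ?_
    rw [Finset.card_univ, Fintype.card_fin, Finset.mul_sum _ _ (C ^ 2)]
    refine mul_le_mul_of_nonneg_left (Finset.sum_le_sum fun j _ => ?_) (by positivity)
    rw [mul_pow]
    refine mul_le_mul_of_nonneg_right ?_ (sq_nonneg _)
    exact sq_le_sq' (abs_le.1 (hC i j)).1 (abs_le.1 (hC i j)).2
  rw [EuclideanSpace.real_norm_sq_eq]
  refine (Finset.sum_le_sum fun i _ => h1 i).trans (le_of_eq ?_)
  rw [Finset.sum_const, Finset.card_univ, Fintype.card_fin, nsmul_eq_mul]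
  ring

end Run

/-! ### Measurability and moments along the recursions -/

section Moments

variable {Ω : Type*} {mΩ : MeasurableSpace Ω} {μ : Measure Ω} {ℱ : Filtration ℕ mΩ} {p : ℕ}
  {R : Run Ω p} {g : Gains} {τ : ℝ} {θ₀ : Vec p} {H₀ : Mat p}

theorem measurable_vec {m : MeasurableSpace Ω} {f : Ω → Vec p}
    (h : ∀ i, Measurable fun ω => f ω i) : Measurable f :=
  (MeasurableEquiv.toLp 2 (Fin p → ℝ)).measurable.comp (measurable_pi_lambda _ h)

theorem measurable_vec_apply {m : MeasurableSpace Ω} {f : Ω → Vec p} (h : Measurable f)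
    (i : Fin p) : Measurable fun ω => f ω i :=
  (EuclideanSpace.proj (𝕜 := ℝ) i).continuous.measurable.comp h

theorem memLp_of_abs_le {X Y : Ω → ℝ} (hX : AEStronglyMeasurable X μ) (hY : MemLp Y 2 μ)
    (h : ∀ᵐ ω ∂μ, |X ω| ≤ |Y ω|) :
    MemLp X 2 μ ∧ ∫ ω, X ω ^ 2 ∂μ ≤ ∫ ω, Y ω ^ 2 ∂μ := by
  have hm : MemLp X 2 μ := hY.mono hX h
  refine ⟨hm, integral_mono_ae hm.integrable_sq hY.integrable_sq ?_⟩
  filter_upwards [h] with ω hω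
  exact sq_le_sq.2 hω

theorem measurable_dir (hmeas : ∀ k i j, Measurable[ℱ (k + 1)] fun ω => R.Hbb τ k ω i j)
    (hG : ∀ k i, Measurable[ℱ (k + 1)] fun ω => R.G k ω i) (k : ℕ) :
    Measurable[ℱ (k + 1)] (R.dir τ k) := by
  refine measurable_vec fun i => ?_
  simp only [Run.dir_apply]
  exact Finset.measurable_sum _ fun j _ => (measurable_inv_apply (hmeas k) i j).mul (hG k j)

theorem measurable_theta (hR : R.Follows g τ θ₀ H₀)
    (hmeas : ∀ k i j, Measurable[ℱ (k + 1)] fun ω => R.Hbb τ k ω i j)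
    (hG : ∀ k i, Measurable[ℱ (k + 1)] fun ω => R.G k ω i) (k : ℕ) :
    Measurable[ℱ k] (R.θ k) := by
  induction k with
  | zero =>
    rw [funext hR.theta_zero]
    exact measurable_const
  | succ k ih =>
    rw [show R.θ (k + 1) = R.θ k - g.a k • R.dir τ k from funext (hR.theta_succ k)]
    exact (ih.mono (ℱ.mono k.le_succ) le_rfl).sub ((measurable_dir hmeas hG k).const_smul _)

theorem memLp_dir {C : ℝ} (hC : ∀ k ω i j, |(R.Hbb τ k ω)⁻¹ i j| ≤ C)
    (hmeas : ∀ k i j, Measurable[ℱ (k + 1)] fun ω => R.Hbb τ k ω i j)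
    (hG : ∀ k i, Measurable[ℱ (k + 1)] fun ω => R.G k ω i)
    (hG2 : ∀ k i, MemLp (fun ω => R.G k ω i) 2 μ) {s : ℕ → ℝ}
    (hGs : ∀ k i, ∫ ω, R.G k ω i ^ 2 ∂μ ≤ s k) (k : ℕ) :
    MemLp (R.dir τ k) 2 μ ∧ ∫ ω, ‖R.dir τ k ω‖ ^ 2 ∂μ ≤ p ^ 2 * C ^ 2 * p * s k := by
  have hm : AEStronglyMeasurable (R.dir τ k) μ :=
    ((measurable_dir hmeas hG k).mono (ℱ.le _) le_rfl).aestronglyMeasurable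
  have hi : Integrable (fun ω => p ^ 2 * C ^ 2 * ∑ i, R.G k ω i ^ 2) μ :=
    (integrable_finsetSum _ fun i _ => (hG2 k i).integrable_sq).const_mul _
  have hsq : Integrable (fun ω => ‖R.dir τ k ω‖ ^ 2) μ := by
    refine hi.mono (hm.norm.pow 2) (Eventually.of_forall fun ω => ?_)
    rw [Real.norm_of_nonneg (sq_nonneg _)]
    exact (norm_sq_dir_le (hC k ω)).trans (Real.le_norm_self _)
  refine ⟨?_, ?_⟩
  · rw [← memLp_norm_iff hm]
    exact (memLp_two_iff_integrable_sq hm.norm).2 hsq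
  · refine (integral_mono hsq hi fun ω => norm_sq_dir_le (hC k ω)).trans ?_
    rw [integral_const_mul, integral_finsetSum _ fun i _ => (hG2 k i).integrable_sq]
    have h1 : ∑ i, ∫ ω, R.G k ω i ^ 2 ∂μ ≤ p * s k :=
      (Finset.sum_le_sum fun i _ => hGs k i).trans_eq (by simp)
    rw [mul_assoc _ (p : ℝ)]
    exact mul_le_mul_of_nonneg_left h1 (by positivity)

theorem ae_summable_dir {C : ℝ} (hC : ∀ k ω i j, |(R.Hbb τ k ω)⁻¹ i j| ≤ C)
    (hmeas : ∀ k i j, Measurable[ℱ (k + 1)] fun ω => R.Hbb τ k ω i j)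
    (hG : ∀ k i, Measurable[ℱ (k + 1)] fun ω => R.G k ω i)
    (hG2 : ∀ k i, MemLp (fun ω => R.G k ω i) 2 μ) {s : ℕ → ℝ}
    (hGs : ∀ k i, ∫ ω, R.G k ω i ^ 2 ∂μ ≤ s k) (hs : Summable fun k => g.a k ^ 2 * s k) :
    ∀ᵐ ω ∂μ, Summable fun k => g.a k ^ 2 * ‖R.dir τ k ω‖ ^ 2 := by
  have h := fun k => memLp_dir (μ := μ) (ℱ := ℱ) hC hmeas hG hG2 hGs k
  refine ae_summable_of_summable_integral (fun k ω => by positivity)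
    (fun k => ((h k).1.norm.integrable_sq).const_mul _) ?_
  refine (hs.mul_left (p ^ 2 * C ^ 2 * p)).of_nonneg_of_le
    (fun k => integral_nonneg fun ω => by positivity) fun k => ?_
  rw [integral_const_mul, mul_left_comm]
  exact mul_le_mul_of_nonneg_left (h k).2 (sq_nonneg _)

/-- Only finiteness for each `k`, for integrability of the inner products; uniformity in `k` is not
needed. -/
theorem memLp_theta [IsFiniteMeasure μ] (hR : R.Follows g τ θ₀ H₀)
    (hd : ∀ k, MemLp (R.dir τ k) 2 μ) (k : ℕ) : MemLp (R.θ k) 2 μ := by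
  induction k with
  | zero =>
    rw [funext hR.theta_zero]
    exact memLp_const _
  | succ k ih =>
    rw [funext (hR.theta_succ k)]
    exact ih.sub ((hd k).const_smul (g.a k))

theorem condExp_apply_ae_eq_zero {m : MeasurableSpace Ω} {f : Ω → Vec p} (hf : Integrable f μ)
    (h : μ[f | m] =ᵐ[μ] 0) (i : Fin p) : μ[fun ω => f ω i | m] =ᵐ[μ] 0 := by
  have h1 := (EuclideanSpace.proj (𝕜 := ℝ) i : Vec p →L[ℝ] ℝ).comp_condExp_comm hf (m := m)
  filter_upwards [h, h1] with ω e0 e1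
  have e2 : (μ[fun ω => f ω i | m]) ω = (μ[f | m]) ω i := e1.symm
  rw [e2, e0]
  rfl

theorem exists_abs_inv_Hbb_le (hR : R.Follows g τ θ₀ H₀) (hτ : 0 < τ) {σ : ℝ}
    (hL : ∀ k ω, sigmaMax (R.L k ω) ≤ σ) :
    ∃ C : ℝ, 0 ≤ C ∧ ∀ k ω i j, |(R.Hbb τ k ω)⁻¹ i j| ≤ C := by
  obtain ⟨C, hC0, hC⟩ := exists_abs_inv_precondition_le p hτ σ
  exact ⟨C, hC0, fun k ω => hC _ _ _ _ _ _ (hR.lbl k ω) (hR.eigen k ω) (hL k ω)⟩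

theorem Is2SG.memLp_Y {loss : Vec p → ℝ} {θs : Vec p} {Y Yp Ym : ℕ → Ω → Vec p} {ρ : ℝ}
    (h : Is2SG R μ ℱ g τ θs loss Y Yp Ym ρ) (k : ℕ) (i : Fin p) :
    MemLp (fun ω => Y k ω i) 2 μ ∧ ∫ ω, Y k ω i ^ 2 ∂μ ≤ ρ ^ 2 := by
  refine memLp_and_integral_sq_le
    ((measurable_vec_apply (h.meas_Y k) i).mono (ℱ.le _) le_rfl).aestronglyMeasurable
    ((eLpNorm_mono fun ω => ?_).trans (h.moment_Y k))
  exact PiLp.norm_apply_le (Y k ω) i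

end Moments

/-! ### Convergence of the iterates -/

section Iterates

variable {Ω : Type*} {mΩ : MeasurableSpace Ω} {μ : Measure Ω} [IsProbabilityMeasure μ]
  {ℱ : Filtration ℕ mΩ} {p : ℕ} {loss : Vec p → ℝ} {θs : Vec p}
  {R : Run Ω p} {g : Gains} {τ σ : ℝ} {θ₀ : Vec p} {H₀ : Mat p}

theorem Run.Follows.sub_succ (hR : R.Follows g τ θ₀ H₀) (θs : Vec p) (k : ℕ) (ω : Ω) :
    R.θ (k + 1) ω - θs = R.θ k ω - θs - g.a k • R.dir τ k ω := by
  rw [hR.theta_succ, sub_right_comm]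

theorem measurable_mul_inv_max (a η : ℝ) :
    Measurable fun x : Vec p => a * (max η ‖x‖)⁻¹ := by fun_prop

theorem ae_tendsto_theta_of_meanDescent (hg : g.Admissible) (hR : R.Follows g τ θ₀ H₀)
    (hmeas : ∀ k i j, Measurable[ℱ (k + 1)] fun ω => R.Hbb τ k ω i j)
    (hG : ∀ k i, Measurable[ℱ (k + 1)] fun ω => R.G k ω i)
    {C : ℝ} (hC : ∀ k ω i j, |(R.Hbb τ k ω)⁻¹ i j| ≤ C)
    (hG2 : ∀ k i, MemLp (fun ω => R.G k ω i) 2 μ) {s : ℕ → ℝ}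
    (hGs : ∀ k i, ∫ ω, R.G k ω i ^ 2 ∂μ ≤ s k) (hs : Summable fun k => g.a k ^ 2 * s k)
    (hdesc : R.MeanDescent μ ℱ τ θs) :
    ∀ᵐ ω ∂μ, Tendsto (fun k => R.θ k ω - θs) atTop (𝓝 0) := by
  have hη : ∀ n : ℕ, 0 < 1 / ((n : ℝ) + 1) := fun n => by positivity
  choose r hr hrae using fun n : ℕ => hdesc _ (hη n)
  have hd := fun k => memLp_dir (μ := μ) (ℱ := ℱ) hC hmeas hG hG2 hGs k
  have hdm : ∀ k, Measurable (R.dir τ k) := fun k =>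
    (measurable_dir hmeas hG k).mono (ℱ.le _) le_rfl
  have hxm : ∀ k, Measurable[ℱ k] fun ω => R.θ k ω - θs := fun k =>
    (measurable_theta hR hmeas hG k).sub_const θs
  have hx : ∀ k, MemLp (fun ω => R.θ k ω - θs) 2 μ := fun k =>
    (memLp_theta hR (fun k => (hd k).1) k).sub (memLp_const θs)
  have hZm : ∀ k, Measurable[ℱ (k + 1)] fun ω => ⟪R.θ k ω - θs, R.dir τ k ω⟫_ℝ := fun k =>
    ((hxm k).mono (ℱ.mono k.le_succ) le_rfl).inner (measurable_dir hmeas hG k)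
  have hZ : ∀ k, Integrable (fun ω => ⟪R.θ k ω - θs, R.dir τ k ω⟫_ℝ) μ := by
    intro k
    have h1 : Integrable (fun ω => ‖R.θ k ω - θs‖ * ‖R.dir τ k ω‖) μ :=
      (hx k).norm.integrable_mul (hd k).1.norm
    refine h1.mono ((hZm k).mono (ℱ.le _) le_rfl).aestronglyMeasurable
      (Eventually.of_forall fun ω => ?_)
    rw [Real.norm_of_nonneg (by positivity : 0 ≤ ‖R.θ k ω - θs‖ * ‖R.dir τ k ω‖)]
    exact norm_inner_le_norm _ _
  have hconv : ∀ n : ℕ, ∀ᵐ ω ∂μ, SeriesConverges fun k =>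
      g.a k * (max (1 / ((n : ℝ) + 1)) ‖R.θ k ω - θs‖)⁻¹ * (⟪R.θ k ω - θs, R.dir τ k ω⟫_ℝ
        - (μ[fun ω' => ⟪R.θ k ω' - θs, R.dir τ k ω'⟫_ℝ | ℱ k]) ω) := by
    intro n
    have hfm : ∀ k, Measurable[ℱ k] fun ω =>
        g.a k * (max (1 / ((n : ℝ) + 1)) ‖R.θ k ω - θs‖)⁻¹ := fun k =>
      (measurable_mul_inv_max (g.a k) _).comp (hxm k)
    -- By Cauchy–Schwarz the weight cancels the distance to `θs`, leaving `a k * ‖dir‖`, whose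
    -- second moments are summable.
    have hb : ∀ k, MemLp (fun ω => g.a k * (max (1 / ((n : ℝ) + 1)) ‖R.θ k ω - θs‖)⁻¹ *
          ⟪R.θ k ω - θs, R.dir τ k ω⟫_ℝ) 2 μ ∧
        ∫ ω, (g.a k * (max (1 / ((n : ℝ) + 1)) ‖R.θ k ω - θs‖)⁻¹ *
          ⟪R.θ k ω - θs, R.dir τ k ω⟫_ℝ) ^ 2 ∂μ ≤ ∫ ω, (g.a k * ‖R.dir τ k ω‖) ^ 2 ∂μ := by
      intro k
      refine memLp_of_abs_le ?_ ((hd k).1.norm.const_mul _) (Eventually.of_forall fun ω => ?_)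
      · exact (((hfm k).mono (ℱ.le _) le_rfl).mul
          ((hZm k).mono (ℱ.le _) le_rfl)).aestronglyMeasurable
      · have hM : 0 < max (1 / ((n : ℝ) + 1)) ‖R.θ k ω - θs‖ := (hη n).trans_le (le_max_left _ _)
        rw [abs_mul, abs_mul, abs_mul, abs_norm, abs_inv, abs_of_pos hM, mul_assoc]
        refine mul_le_mul_of_nonneg_left ?_ (abs_nonneg _)
        rw [inv_mul_le_iff₀ hM]
        exact (abs_real_inner_le_norm _ _).trans
          (mul_le_mul_of_nonneg_right (le_max_right _ _) (norm_nonneg _))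
    refine ae_seriesConverges_noise (μ := μ) ℱ (fun k => le_rfl) (fun k => ℱ.mono k.le_succ)
      hfm (fun k => stronglyMeasurable_condExp.measurable) hZm hZ
      (fun k => (hZ k).sub integrable_condExp) (fun k => ?_) (fun k => (hb k).1) ?_
    · have h1 := condExp_sub (μ := μ) (hZ k) (integrable_condExp (m := ℱ k)
        (f := fun ω => ⟪R.θ k ω - θs, R.dir τ k ω⟫_ℝ)) (ℱ k)
      rw [condExp_of_stronglyMeasurable (ℱ.le k) stronglyMeasurable_condExp integrable_condExp,
        sub_self] at h1
      exact h1
    · refine (hs.mul_left (p ^ 2 * C ^ 2 * p)).of_nonneg_of_le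
        (fun k => integral_nonneg fun ω => sq_nonneg _) fun k => (hb k).2.trans ?_
      simp only [mul_pow, integral_const_mul]
      rw [mul_left_comm]
      have := (hd k).2
      rw [mul_assoc] at this ⊢
      exact mul_le_mul_of_nonneg_left this (sq_nonneg _)
  filter_upwards [ae_all_iff.2 hrae, ae_all_iff.2 hconv,
    ae_summable_dir (μ := μ) (ℱ := ℱ) hC hmeas hG hG2 hGs hs] with ω h1 h2 h3
  exact tendsto_zero_of_descent hg.a_pos hg.a_sum (fun k => hR.sub_succ θs k ω) h3
    fun n => ⟨r n, hr n, _, h1 n, h2 n⟩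

theorem measurable_gradient (hloss : ContDiff ℝ 2 loss) : Measurable (gradient loss) := by
  have : Continuous fun x => (InnerProductSpace.toDual ℝ (Vec p)).symm (fderiv ℝ loss x) :=
    (LinearIsometryEquiv.continuous _).comp (hloss.continuous_fderiv (by norm_num))
  exact this.measurable

/-- Descent concerns the true gradient multiplied by the current inverse matrix, so the noise is
centred given the past and that matrix. Working entry by entry, only integrability of single noise
components is required. -/
theorem Is2SG.ae_tendsto_theta (hloss : ContDiff ℝ 2 loss) (hg : g.Admissible)
    (hR : R.Follows g τ θ₀ H₀)
    (hmeas : ∀ k i j, Measurable[ℱ (k + 1)] fun ω => R.Hbb τ k ω i j)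
    {C : ℝ} (hC : ∀ k ω i j, |(R.Hbb τ k ω)⁻¹ i j| ≤ C)
    {Y Yp Ym : ℕ → Ω → Vec p} {ρ : ℝ} (h : Is2SG R μ ℱ g τ θs loss Y Yp Ym ρ) :
    ∀ᵐ ω ∂μ, Tendsto (fun k => R.θ k ω - θs) atTop (𝓝 0) := by
  have hη : ∀ n : ℕ, 0 < 1 / ((n : ℝ) + 1) := fun n => by positivity
  choose r hr hrae using fun n : ℕ => h.descent _ (hη n)
  have hYm : ∀ k i, Measurable[ℱ (k + 1)] fun ω => Y k ω i := fun k i =>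
    measurable_vec_apply (h.meas_Y k) i
  have hG : ∀ k i, Measurable[ℱ (k + 1)] fun ω => R.G k ω i := fun k i => by
    simpa only [h.G_eq] using hYm k i
  have hG2 : ∀ k i, MemLp (fun ω => R.G k ω i) 2 μ := fun k i => by
    simpa only [h.G_eq] using (h.memLp_Y k i).1
  have hGs : ∀ k i, ∫ ω, R.G k ω i ^ 2 ∂μ ≤ ρ ^ 2 := fun k i => by
    simpa only [h.G_eq] using (h.memLp_Y k i).2
  have hs : Summable fun k => g.a k ^ 2 * ρ ^ 2 := h.a_summable.mul_right _
  set 𝒢 : ℕ → MeasurableSpace Ω := fun k => ℱ k ⊔ MeasurableSpace.comap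
    (fun ω i j => R.Hbb τ k ω i j) (inferInstanceAs (MeasurableSpace (Fin p → Fin p → ℝ)))
  have hle : ∀ k, ℱ k ≤ 𝒢 k := fun k => le_sup_left
  have hle' : ∀ k, 𝒢 k ≤ ℱ (k + 1) := fun k => sup_le (ℱ.mono k.le_succ)
    (Measurable.comap_le (@measurable_pi_lambda _ _ _ (ℱ (k + 1)) _ _ fun i =>
      @measurable_pi_lambda _ _ _ (ℱ (k + 1)) _ _ fun j => hmeas k i j))
  have hHm : ∀ k i j, Measurable[𝒢 k] fun ω => R.Hbb τ k ω i j := fun k i j =>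
    (((measurable_pi_apply j).comp (measurable_pi_apply (X := fun _ => Fin p → ℝ) i)).comp
      (comap_measurable (fun ω i j => R.Hbb τ k ω i j))).mono le_sup_right le_rfl
  have hθm : ∀ k, Measurable[𝒢 k] (R.θ k) := fun k =>
    (measurable_theta hR hmeas hG k).mono (hle k) le_rfl
  have hxm : ∀ k, Measurable[𝒢 k] fun ω => R.θ k ω - θs := fun k => (hθm k).sub_const θs
  have hconv : ∀ (n : ℕ) (j i : Fin p), ∀ᵐ ω ∂μ, SeriesConverges fun k =>
      (g.a k * (max (1 / ((n : ℝ) + 1)) ‖R.θ k ω - θs‖)⁻¹ * ((R.θ k ω - θs) j *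
        (R.Hbb τ k ω)⁻¹ j i)) * (Y k ω i - gradient loss (R.θ k ω) i) := by
    intro n j i
    have hfm : ∀ k, Measurable[𝒢 k] fun ω =>
        g.a k * (max (1 / ((n : ℝ) + 1)) ‖R.θ k ω - θs‖)⁻¹ * ((R.θ k ω - θs) j *
        (R.Hbb τ k ω)⁻¹ j i) := fun k =>
      ((measurable_mul_inv_max (g.a k) _).comp (hxm k)).mul
        ((measurable_vec_apply (hxm k) j).mul (measurable_inv_apply (hHm k) j i))
    -- The weight absorbs `|(θ - θs) j|`, and `C` bounds the entry of the inverse.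
    have hb : ∀ k, MemLp (fun ω => (g.a k * (max (1 / ((n : ℝ) + 1)) ‖R.θ k ω - θs‖)⁻¹ *
          ((R.θ k ω - θs) j * (R.Hbb τ k ω)⁻¹ j i)) * Y k ω i) 2 μ ∧
        ∫ ω, ((g.a k * (max (1 / ((n : ℝ) + 1)) ‖R.θ k ω - θs‖)⁻¹ *
          ((R.θ k ω - θs) j * (R.Hbb τ k ω)⁻¹ j i)) * Y k ω i) ^ 2 ∂μ
          ≤ ∫ ω, (g.a k * C * Y k ω i) ^ 2 ∂μ := by
      intro k
      refine memLp_of_abs_le ?_ ((h.memLp_Y k i).1.const_mul _) (Eventually.of_forall fun ω => ?_)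
      · exact (((hfm k).mono ((hle' k).trans (ℱ.le _)) le_rfl).mul
          ((hYm k i).mono (ℱ.le _) le_rfl)).aestronglyMeasurable
      · have hM : 0 < max (1 / ((n : ℝ) + 1)) ‖R.θ k ω - θs‖ := (hη n).trans_le (le_max_left _ _)
        have hC0 : 0 ≤ C := (abs_nonneg _).trans (hC k ω j i)
        rw [abs_mul, abs_mul (_ * _) (Y k ω i)]
        refine mul_le_mul_of_nonneg_right ?_ (abs_nonneg _)
        rw [abs_mul, abs_mul, abs_mul, abs_mul, abs_inv, abs_of_pos hM, mul_assoc]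
        refine mul_le_mul_of_nonneg_left ?_ (abs_nonneg _)
        rw [inv_mul_le_iff₀ hM]
        refine mul_le_mul ?_ ((hC k ω j i).trans (le_abs_self _)) (abs_nonneg _) hM.le
        exact (PiLp.norm_apply_le (R.θ k ω - θs) j).trans (le_max_right _ _)
    refine ae_seriesConverges_noise (μ := μ) ℱ hle hle' hfm
      (fun k => measurable_vec_apply ((measurable_gradient hloss).comp (hθm k)) i)
      (fun k => hYm k i) (fun k => (h.memLp_Y k i).1.integrable one_le_two)
      (fun k => (EuclideanSpace.proj (𝕜 := ℝ) i : Vec p →L[ℝ] ℝ).integrable_comp (h.int_Y k))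
      (fun k => condExp_apply_ae_eq_zero (h.int_Y k) (h.noise_grad k) i)
      (fun k => (hb k).1) ?_
    refine (hs.mul_left (C ^ 2)).of_nonneg_of_le
      (fun k => integral_nonneg fun ω => sq_nonneg _) fun k => (hb k).2.trans ?_
    simp only [mul_pow, integral_const_mul]
    rw [mul_comm (g.a k ^ 2), mul_assoc]
    gcongr
    exact (h.memLp_Y k i).2
  filter_upwards [ae_all_iff.2 hrae, ae_all_iff.2 fun n => ae_all_iff.2 fun j =>
    ae_all_iff.2 fun i => hconv n j i,
    ae_summable_dir (μ := μ) (ℱ := ℱ) hC hmeas hG hG2 hGs hs] with ω h1 h2 h3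
  refine tendsto_zero_of_descent hg.a_pos hg.a_sum (fun k => hR.sub_succ θs k ω) h3
    fun n => ⟨r n, hr n, _, h1 n, ?_⟩
  have h4 := SeriesConverges.sum Finset.univ fun j _ =>
    SeriesConverges.sum Finset.univ fun i _ => h2 n j i
  refine (congrArg SeriesConverges (funext fun k => ?_)).mp h4
  have e : ∀ v : Fin p → ℝ, ⟪R.θ k ω - θs, (WithLp.toLp 2 ((R.Hbb τ k ω)⁻¹ *ᵥ v) : Vec p)⟫_ℝ
      = ∑ j, ∑ i, (R.θ k ω - θs) j * (R.Hbb τ k ω)⁻¹ j i * v i := by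
    intro v
    simp only [PiLp.inner_apply, Matrix.mulVec, dotProduct, RCLike.inner_apply, conj_trivial,
      Finset.sum_mul]
    exact Finset.sum_congr rfl fun j _ => Finset.sum_congr rfl fun i _ => by ring
  rw [Run.dir, e, e, h.G_eq, ← Finset.sum_sub_distrib, Finset.mul_sum]
  refine Finset.sum_congr rfl fun j _ => ?_
  rw [← Finset.sum_sub_distrib, Finset.mul_sum]
  exact Finset.sum_congr rfl fun i _ => by ring

end Iterates

/-! ### Convergence of the Hessian estimates -/

section Hessian

variable {p : ℕ}

theorem norm_le_of_abs_le {v : Vec p} {ρ : ℝ} (h : ∀ i, |v i| ≤ ρ) : ‖v‖ ≤ √(p * ρ ^ 2) := by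
  refine Real.le_sqrt_of_sq_le ?_
  rw [EuclideanSpace.real_norm_sq_eq]
  refine (Finset.sum_le_sum fun i _ => ?_).trans_eq (by simp : ∑ _i : Fin p, ρ ^ 2 = p * ρ ^ 2)
  exact sq_le_sq' (abs_le.1 (h i)).1 (abs_le.1 (h i)).2

theorem tendsto_mul_norm_of_le {c : ℕ → ℝ} {D : ℕ → Vec p} {K : ℝ} (hc0 : ∀ k, 0 < c k)
    (hc : Tendsto c atTop (𝓝 0)) (hD : ∀ k, ‖D k‖ ≤ K) :
    Tendsto (fun k => c k * ‖D k‖) atTop (𝓝 0) := by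
  have h1 : Tendsto (fun k => c k * K) atTop (𝓝 0) := by simpa using hc.mul_const K
  exact squeeze_zero (fun k => mul_nonneg (hc0 k).le (norm_nonneg _))
    (fun k => mul_le_mul_of_nonneg_left (hD k) (hc0 k).le) h1

theorem Is2SG.measurable_Δ {Ω : Type*} {mΩ : MeasurableSpace Ω} {μ : Measure Ω} {ℱ : Filtration ℕ mΩ}
    {loss : Vec p → ℝ} {θs : Vec p} {R : Run Ω p} {g : Gains} {τ : ℝ} {Y Yp Ym : ℕ → Ω → Vec p} {ρ : ℝ}
    (h : Is2SG R μ ℱ g τ θs loss Y Yp Ym ρ) (k : ℕ) : Measurable[ℱ (k + 1)] (R.Δ k) :=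
  measurable_vec fun i => h.perturbation.meas k i

/-- The convergent sequence `c` is bounded. The series of perturbation ratios need only this weaker
summability. -/
theorem summable_sq_of_summable_div_sq {w c : ℕ → ℝ} (hc0 : ∀ k, 0 < c k)
    (hc : Tendsto c atTop (𝓝 0)) (h : Summable fun k => (w k / c k) ^ 2) :
    Summable fun k => w k ^ 2 := by
  obtain ⟨b, hb⟩ := hc.bddAbove_range
  refine (h.mul_left (b ^ 2)).of_nonneg_of_le (fun k => sq_nonneg _) fun k => ?_
  have h1 : c k ≤ b := hb ⟨k, rfl⟩
  have h2 : w k ^ 2 = c k ^ 2 * (w k / c k) ^ 2 := by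
    rw [← mul_pow, mul_div_cancel₀ _ (hc0 k).ne']
  rw [h2]
  exact mul_le_mul_of_nonneg_right (pow_le_pow_left₀ (hc0 k).le h1 2) (sq_nonneg _)

variable {Ω : Type*} {mΩ : MeasurableSpace Ω} {μ : Measure Ω} [IsProbabilityMeasure μ]
  {ℱ : Filtration ℕ mΩ} {loss : Vec p → ℝ} {θs : Vec p}
  {R : Run Ω p} {g : Gains} {τ : ℝ} {θ₀ : Vec p} {H₀ : Mat p}

theorem integral_abs_le {f : Ω → ℝ} {S : ℝ} (hf : MemLp f 2 μ) (hS : ∫ ω, f ω ^ 2 ∂μ ≤ S) :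
    ∫ ω, |f ω| ∂μ ≤ 1 + S := by
  calc ∫ ω, |f ω| ∂μ ≤ ∫ ω, (1 + f ω ^ 2) ∂μ := by
        refine integral_mono (hf.integrable one_le_two).abs
          ((integrable_const _).add hf.integrable_sq) fun ω => ?_
        simp only
        rw [← sq_abs (f ω)]
        nlinarith [sq_nonneg (|f ω| - 1)]
    _ = 1 + ∫ ω, f ω ^ 2 ∂μ := by
        rw [integral_add (integrable_const _) hf.integrable_sq]; simp
    _ ≤ 1 + S := by linarith

/-- Averages of a sequence that is eventually small relative to `|Y k ω|`, where the `Y k` are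
independent of the past with bounded second moments. -/
theorem ae_averagesToZero_of_small {w : ℕ → ℝ} (hw : IsWeight w)
    (hw2 : Summable fun k => w k ^ 2) {m : ℕ → MeasurableSpace Ω} (hm : ∀ k, m k ≤ ℱ (k + 1))
    (hind : ∀ k, Indep (m k) (ℱ k) μ)
    {Y : ℕ → Ω → ℝ} (hY : ∀ k, Measurable[m k] (Y k)) (hL2 : ∀ k, MemLp (Y k) 2 μ) {S : ℝ}
    (hS : ∀ k, ∫ ω, Y k ω ^ 2 ∂μ ≤ S) :
    -- `X` is quantified inside the almost sure statement, so it may be the remainder along the path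
    -- `ω`, and its measurability plays no role.
    ∀ᵐ ω ∂μ, ∀ X : ℕ → ℝ, (∀ ε : ℝ, 0 < ε → ∀ᶠ k in atTop, |X k| ≤ ε * |Y k ω|) →
      AveragesToZero w X := by
  have h1 := ae_seriesConverges_indep (μ := μ) ℱ hm hind (Y := fun k ω => |Y k ω|)
    (fun k => measurable_norm.comp (hY k)) (fun k => (hL2 k).abs) (C := S) (fun k => by
      simpa only [sq_abs] using hS k) hw2
  filter_upwards [h1] with ω e1 X hX
  exact hw.averagesToZero_of_small (fun k => integral_abs_le (hL2 k) (hS k))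
    (hw.averagesToZero_of_seriesConverges e1) hX

theorem Is2SG.ae_seriesConverges_noise (hloss : ContDiff ℝ 2 loss) (hg : g.Admissible)
    (hθm : ∀ k, Measurable[ℱ k] (R.θ k)) {Y Yp Ym : ℕ → Ω → Vec p} {ρ : ℝ}
    (h : Is2SG R μ ℱ g τ θs loss Y Yp Ym ρ) (i j : Fin p) :
    ∀ᵐ ω ∂μ, SeriesConverges fun k => g.w k / (2 * g.c k) * (R.Δ k ω j)⁻¹ *
      ((Yp k ω i - Ym k ω i) - (gradient loss (R.θ k ω + g.c k • R.Δ k ω) i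
        - gradient loss (R.θ k ω - g.c k • R.Δ k ω) i)) := by
  set 𝒢 : ℕ → MeasurableSpace Ω := fun k => ℱ k ⊔ MeasurableSpace.comap (R.Δ k) inferInstance
   
  have hle : ∀ k, ℱ k ≤ 𝒢 k := fun k => le_sup_left
  have hle' : ∀ k, 𝒢 k ≤ ℱ (k + 1) := fun k => sup_le (ℱ.mono k.le_succ)
    (Measurable.comap_le (h.measurable_Δ k))
  have hΔ : ∀ k, Measurable[𝒢 k] (R.Δ k) := fun k =>
    (comap_measurable (R.Δ k)).mono le_sup_right le_rfl
  have hθ : ∀ k, Measurable[𝒢 k] (R.θ k) := fun k => (hθm k).mono (hle k) le_rfl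
  have hgr := measurable_gradient hloss
  have hYp : ∀ k, Measurable[ℱ (k + 1)] fun ω => Yp k ω i := fun k =>
    measurable_vec_apply (h.meas_Yp k) i
  have hYm : ∀ k, Measurable[ℱ (k + 1)] fun ω => Ym k ω i := fun k =>
    measurable_vec_apply (h.meas_Ym k) i
  have hΔj : ∀ k, Measurable[ℱ (k + 1)] fun ω => R.Δ k ω j := fun k => h.perturbation.meas k j
  have hp : ∀ k, MemLp (fun ω => Yp k ω i / R.Δ k ω j) 2 μ ∧
      ∫ ω, (Yp k ω i / R.Δ k ω j) ^ 2 ∂μ ≤ ρ ^ 2 := fun k => memLp_and_integral_sq_le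
    (((hYp k).div (hΔj k)).mono (ℱ.le _) le_rfl).aestronglyMeasurable (h.moment_Yp k i j)
  have hm : ∀ k, MemLp (fun ω => Ym k ω i / R.Δ k ω j) 2 μ ∧
      ∫ ω, (Ym k ω i / R.Δ k ω j) ^ 2 ∂μ ≤ ρ ^ 2 := fun k => memLp_and_integral_sq_le
    (((hYm k).div (hΔj k)).mono (ℱ.le _) le_rfl).aestronglyMeasurable (h.moment_Ym k i j)
  have hdiff : ∀ k, MemLp (fun ω => Yp k ω i / R.Δ k ω j - Ym k ω i / R.Δ k ω j) 2 μ := fun k => (hp k).1.sub (hm k).1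
  -- Moments are assumed for quotients only; multiplying back by the bounded, almost surely nonzero
  -- component recovers integrability.
  have hZ : ∀ k, Integrable (fun ω => Yp k ω i - Ym k ω i) μ := by
    intro k
    refine ((h.perturbation.memLp k j 2).integrable_mul (hdiff k)).congr ?_
    filter_upwards [h.perturbation.ne_zero k j] with ω hω
    simp only [Pi.mul_apply]
    field_simp
  have hfZ : ∀ k ω, g.w k / (2 * g.c k) * (R.Δ k ω j)⁻¹ * (Yp k ω i - Ym k ω i)
      = g.w k / (2 * g.c k) * (Yp k ω i / R.Δ k ω j - Ym k ω i / R.Δ k ω j) := fun k ω => by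
    simp only [div_eq_mul_inv]; ring
  have hN : ∀ k, Integrable (fun ω => ((Yp k ω i - Ym k ω i)
      - (gradient loss (R.θ k ω + g.c k • R.Δ k ω) i
        - gradient loss (R.θ k ω - g.c k • R.Δ k ω) i))) μ ∧
      μ[fun ω => ((Yp k ω i - Ym k ω i) - (gradient loss (R.θ k ω + g.c k • R.Δ k ω) i
        - gradient loss (R.θ k ω - g.c k • R.Δ k ω) i)) | 𝒢 k] =ᵐ[μ] 0 := by
    intro k
    have hi := (h.int_Yp k).sub (h.int_Ym k)
    have e : (fun ω => ((Yp k ω i - Ym k ω i) - (gradient loss (R.θ k ω + g.c k • R.Δ k ω) i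
        - gradient loss (R.θ k ω - g.c k • R.Δ k ω) i)))
        = fun ω => ((Yp k ω - gradient loss (R.θ k ω + g.c k • R.Δ k ω))
          - (Ym k ω - gradient loss (R.θ k ω - g.c k • R.Δ k ω))) i := by
      funext ω
      simp only [PiLp.sub_apply]
      ring
    rw [e]
    exact ⟨(EuclideanSpace.proj (𝕜 := ℝ) i : Vec p →L[ℝ] ℝ).integrable_comp hi,
      condExp_apply_ae_eq_zero hi (h.noise k) i⟩
  refine SecondOrderSP.ae_seriesConverges_noise (μ := μ) ℱ hle hle'
    (fun k => (measurable_vec_apply (hΔ k) j).inv.const_mul _)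
    (fun k => (measurable_vec_apply (hgr.comp ((hθ k).add ((hΔ k).const_smul (g.c k)))) i).sub
      (measurable_vec_apply (hgr.comp ((hθ k).sub ((hΔ k).const_smul (g.c k)))) i))
    (fun k => (hYp k).sub (hYm k)) hZ (fun k => (hN k).1) (fun k => (hN k).2) (fun k => ?_) ?_
  · simp only [hfZ]
    exact (hdiff k).const_mul _
  · simp only [hfZ, mul_pow, integral_const_mul]
    refine (h.w_summable.mul_right (ρ ^ 2)).of_nonneg_of_le
      (fun k => mul_nonneg (sq_nonneg _) (integral_nonneg fun ω => sq_nonneg _)) fun k => ?_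
    have h1 := integral_sub_sq_le (hp k).1 (hm k).1 (hp k).2 (hm k).2
    calc (g.w k / (2 * g.c k)) ^ 2 * ∫ ω, (Yp k ω i / R.Δ k ω j - Ym k ω i / R.Δ k ω j) ^ 2 ∂μ
        ≤ (g.w k / (2 * g.c k)) ^ 2 * (4 * ρ ^ 2) := mul_le_mul_of_nonneg_left h1 (sq_nonneg _)
      _ = (g.w k / g.c k) ^ 2 * ρ ^ 2 := by
        have := (hg.c_pos k).ne'
        field_simp
        norm_num

/-- The error is the sum of noise (`hA1`), fluctuations of the ratios `Δ l / Δ j` (`hA2`) and the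
remainder of the gradient expansion at `θs` (`hA3`). -/
theorem Is2SG.ae_averagesToZero (hloss : ContDiff ℝ 2 loss) (hg : g.Admissible)
    (hθm : ∀ k, Measurable[ℱ k] (R.θ k)) (hH : (hessian loss θs).IsHermitian)
    (hθ : ∀ᵐ ω ∂μ, Tendsto (fun k => R.θ k ω - θs) atTop (𝓝 0))
    {Y Yp Ym : ℕ → Ω → Vec p} {ρ : ℝ} (h : Is2SG R μ ℱ g τ θs loss Y Yp Ym ρ) (i j : Fin p) :
    ∀ᵐ ω ∂μ, AveragesToZero g.w fun k =>
      R.δG k ω i / (2 * g.c k) * (R.Δ k ω j)⁻¹ - hessian loss θs i j := by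
  have hw := hg.isWeight
  have hw2 := summable_sq_of_summable_div_sq hg.c_pos hg.c_tendsto h.w_summable
  have hpert := h.perturbation
  have hmc := fun k i => IsPerturbation.measurable_comap (fun k (i : Fin p) ω => R.Δ k ω i) k i
  have hratio : ∀ l, ∀ᵐ ω ∂μ, SeriesConverges fun k =>
      g.w k * (R.Δ k ω l * (R.Δ k ω j)⁻¹ - if l = j then 1 else 0) := by
    intro l
    have := ae_seriesConverges_indep (μ := μ) ℱ hpert.comap_le hpert.indep_past
      (Y := fun k ω => R.Δ k ω l * (R.Δ k ω j)⁻¹) (fun k => (hmc k l).mul (hmc k j).inv)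
      (fun k => (hpert.memLp_ratio k l j).1) (fun k => (hpert.memLp_ratio k l j).2) hw2
    simpa only [fun k => hpert.integral_ratio k l j] using this
  have hrem := ae_averagesToZero_of_small (μ := μ) hw hw2 hpert.comap_le hpert.indep_past
    (Y := fun k ω => (R.Δ k ω j)⁻¹) (fun k => (hmc k j).inv)
    (fun k => (hpert.memLp_inv k j).1) (fun k => (hpert.memLp_inv k j).2)
  filter_upwards [hθ, h.ae_seriesConverges_noise hloss hg hθm i j, ae_all_iff.2 hratio, hrem,
    ae_all_iff.2 fun k => ae_all_iff.2 fun i => hpert.bdd k i] with ω eθ eN eR erem eb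
  set K : ℝ := √(p * ρ ^ 2) with hK
  have hΔK : ∀ k, ‖R.Δ k ω‖ ≤ K := fun k => norm_le_of_abs_le (eb k)
  have hcn : ∀ k, 0 < g.c k := hg.c_pos
  have hA1 : AveragesToZero g.w fun k => 1 / (2 * g.c k) * (R.Δ k ω j)⁻¹ *
      ((Yp k ω i - Ym k ω i) - (gradient loss (R.θ k ω + g.c k • R.Δ k ω) i
        - gradient loss (R.θ k ω - g.c k • R.Δ k ω) i)) := by
    refine hw.averagesToZero_of_seriesConverges ?_
    refine (congrArg SeriesConverges (funext fun k => ?_)).mp eN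
    ring
  have hA2 : AveragesToZero g.w fun k => ∑ l, hessian loss θs l i *
      (R.Δ k ω l * (R.Δ k ω j)⁻¹ - if l = j then 1 else 0) :=
    AveragesToZero.sum Finset.univ (hw.averagesToZero_of_tendsto tendsto_const_nhds) fun l _ =>
      (hw.averagesToZero_of_seriesConverges (eR l)).const_mul _
  have hA3 : AveragesToZero g.w fun k => 1 / (2 * g.c k) * (R.Δ k ω j)⁻¹ *
      ((gradient loss (R.θ k ω + g.c k • R.Δ k ω) i
        - gradient loss (R.θ k ω - g.c k • R.Δ k ω) i)
        - 2 * g.c k * ∑ l, R.Δ k ω l * hessian loss θs l i) := by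
    refine erem _ fun ε hε => ?_
    have hK1 : 0 < K + 1 := by positivity
    obtain ⟨δ, hδ, hd⟩ := exists_gradient_diff_le hloss θs (ε := ε / (K + 1)) (by positivity)
    have hlim : Tendsto (fun k => ‖R.θ k ω - θs‖ + g.c k * ‖R.Δ k ω‖) atTop (𝓝 0) := by
      simpa using eθ.norm.add (tendsto_mul_norm_of_le hcn hg.c_tendsto hΔK)
    filter_upwards [hlim.eventually (gt_mem_nhds hδ)] with k hk
    have h1 := hd _ _ _ (hcn k) hk i
    have h2c : 0 < 1 / (2 * g.c k) := by have := hcn k; positivity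
    rw [abs_mul, abs_mul, abs_of_pos h2c]
    calc 1 / (2 * g.c k) * |(R.Δ k ω j)⁻¹| * _
        ≤ 1 / (2 * g.c k) * |(R.Δ k ω j)⁻¹| * (ε / (K + 1) * (2 * g.c k * (K + 1))) := by
          refine mul_le_mul_of_nonneg_left (h1.trans ?_) (by positivity)
          have := hcn k
          gcongr
          linarith [hΔK k]
      _ = ε * |(R.Δ k ω j)⁻¹| := by
          have := (hcn k).ne'
          field_simp
  refine (congrArg (AveragesToZero g.w) (funext fun k => ?_)).mp ((hA1.add hA2).add hA3)
  have e1 : ∑ l, hessian loss θs l i * (R.Δ k ω l * (R.Δ k ω j)⁻¹ - if l = j then 1 else 0)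
      = (R.Δ k ω j)⁻¹ * (∑ l, R.Δ k ω l * hessian loss θs l i) - hessian loss θs j i := by
    simp only [mul_sub, Finset.sum_sub_distrib, mul_ite, mul_one, mul_zero, Finset.sum_ite_eq',
      Finset.mem_univ, if_true, Finset.mul_sum]
    congr 1
    exact Finset.sum_congr rfl fun l _ => by ring
  -- The expansion produces the transposed entry, so symmetry is used here.
  have e2 : hessian loss θs j i = hessian loss θs i j := by simpa using hH.apply i j
  rw [e1, e2, h.δG_eq, PiLp.sub_apply]
  have := (hcn k).ne'
  field_simp
  ring

end Hessian

/-! ### Iterates and Hessian estimates in the gradient-free setting -/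

section Hessian

variable {Ω : Type*} {mΩ : MeasurableSpace Ω} {μ : Measure Ω} {ℱ : Filtration ℕ mΩ} {p : ℕ}
  {loss : Vec p → ℝ} {θs : Vec p} {R : Run Ω p} {g : Gains} {τ : ℝ} {c' : ℕ → ℝ}
  {Δ' : ℕ → Ω → Vec p} {yp ym ytp ytm : ℕ → Ω → ℝ} {ρ : ℝ}

theorem Is2SPSA.measurable_Δ (h : Is2SPSA R μ ℱ g τ θs loss c' Δ' yp ym ytp ytm ρ) (k : ℕ) :
    Measurable[ℱ (k + 1)] (R.Δ k) :=
  measurable_vec fun i => h.perturbation.meas k (Sum.inl i)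

theorem Is2SPSA.measurable_Δ' (h : Is2SPSA R μ ℱ g τ θs loss c' Δ' yp ym ytp ytm ρ) (k : ℕ) :
    Measurable[ℱ (k + 1)] (Δ' k) :=
  measurable_vec fun i => h.perturbation.meas k (Sum.inr i)

theorem Is2SPSA.G_apply (h : Is2SPSA R μ ℱ g τ θs loss c' Δ' yp ym ytp ytm ρ) (k : ℕ) (ω : Ω)
    (i : Fin p) : R.G k ω i = (2 * g.c k)⁻¹ * (yp k ω / R.Δ k ω i - ym k ω / R.Δ k ω i) := by
  rw [h.G_eq]
  simp only [twoSidedGrad, recip, PiLp.smul_apply, smul_eq_mul, div_eq_mul_inv]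
  ring

theorem Is2SPSA.measurable_G (h : Is2SPSA R μ ℱ g τ θs loss c' Δ' yp ym ytp ytm ρ) (k : ℕ)
    (i : Fin p) : Measurable[ℱ (k + 1)] fun ω => R.G k ω i := by
  simp only [h.G_apply]
  have := measurable_vec_apply (h.measurable_Δ k) i
  exact (((h.meas_yp k).div this).sub ((h.meas_ym k).div this)).const_mul _

/-- The second moment may grow like `c⁻²`; this is why the step sizes enter as `a / c`. -/
theorem Is2SPSA.memLp_G (hg : g.Admissible) (h : Is2SPSA R μ ℱ g τ θs loss c' Δ' yp ym ytp ytm ρ)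
    (k : ℕ) (i : Fin p) : MemLp (fun ω => R.G k ω i) 2 μ ∧
      ∫ ω, R.G k ω i ^ 2 ∂μ ≤ (1 / g.c k) ^ 2 * ρ ^ 2 := by
  have hΔ := measurable_vec_apply (h.measurable_Δ k) i
  have hp : MemLp (fun ω => yp k ω / R.Δ k ω i) 2 μ ∧ ∫ ω, (yp k ω / R.Δ k ω i) ^ 2 ∂μ ≤ ρ ^ 2 :=
    memLp_and_integral_sq_le (((h.meas_yp k).div hΔ).mono (ℱ.le _) le_rfl).aestronglyMeasurable
      (h.moment_yp k i)
  have hm : MemLp (fun ω => ym k ω / R.Δ k ω i) 2 μ ∧ ∫ ω, (ym k ω / R.Δ k ω i) ^ 2 ∂μ ≤ ρ ^ 2 :=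
    memLp_and_integral_sq_le (((h.meas_ym k).div hΔ).mono (ℱ.le _) le_rfl).aestronglyMeasurable
      (h.moment_ym k i)
  simp only [h.G_apply]
  refine ⟨(hp.1.sub hm.1).const_mul _, ?_⟩
  simp only [mul_pow, integral_const_mul]
  calc (2 * g.c k)⁻¹ ^ 2 * ∫ ω, (yp k ω / R.Δ k ω i - ym k ω / R.Δ k ω i) ^ 2 ∂μ
      ≤ (2 * g.c k)⁻¹ ^ 2 * (4 * ρ ^ 2) :=
        mul_le_mul_of_nonneg_left (integral_sub_sq_le hp.1 hm.1 hp.2 hm.2) (sq_nonneg _)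
    _ = (1 / g.c k) ^ 2 * ρ ^ 2 := by
      have := (hg.c_pos k).ne'
      field_simp
      norm_num

variable [IsProbabilityMeasure μ] {θ₀ : Vec p} {H₀ : Mat p}

theorem Is2SPSA.ae_tendsto_theta (hg : g.Admissible) (hR : R.Follows g τ θ₀ H₀)
    (hmeas : ∀ k i j, Measurable[ℱ (k + 1)] fun ω => R.Hbb τ k ω i j)
    {C : ℝ} (hC : ∀ k ω i j, |(R.Hbb τ k ω)⁻¹ i j| ≤ C)
    (h : Is2SPSA R μ ℱ g τ θs loss c' Δ' yp ym ytp ytm ρ) :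
    ∀ᵐ ω ∂μ, Tendsto (fun k => R.θ k ω - θs) atTop (𝓝 0) := by
  refine ae_tendsto_theta_of_meanDescent (μ := μ) (ℱ := ℱ) hg hR hmeas h.measurable_G hC
    (fun k i => (h.memLp_G hg k i).1) (fun k i => (h.memLp_G hg k i).2) ?_ h.descent
  refine (h.a_summable.mul_right (ρ ^ 2)).congr fun k => ?_
  ring

/-- The noise in one of the two one-sided differences of a Hessian estimate, taken at `z k`. -/
theorem Is2SPSA.ae_seriesConverges_noise (hloss : ContDiff ℝ 2 loss) (hg : g.Admissible)
    (h : Is2SPSA R μ ℱ g τ θs loss c' Δ' yp ym ytp ytm ρ) (i j : Fin p)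
    {yt y : ℕ → Ω → ℝ} {z : ℕ → Ω → Vec p}
    (hyt : ∀ k, Measurable[ℱ (k + 1)] (yt k)) (hy : ∀ k, Measurable[ℱ (k + 1)] (y k))
    (hz : ∀ k, Measurable[ℱ k ⊔ MeasurableSpace.comap (R.Δ k) inferInstance] (z k))
    (hiyt : ∀ k, Integrable (fun ω => yt k ω - loss (z k ω + c' k • Δ' k ω)) μ)
    (hiy : ∀ k, Integrable (fun ω => y k ω - loss (z k ω)) μ)
    (hnoise : ∀ k, μ[fun ω => (yt k ω - loss (z k ω + c' k • Δ' k ω)) - (y k ω - loss (z k ω))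
      | (ℱ k ⊔ MeasurableSpace.comap (R.Δ k) inferInstance)
          ⊔ MeasurableSpace.comap (Δ' k) inferInstance] =ᵐ[μ] 0)
    (hmyt : ∀ k, eLpNorm (fun ω => yt k ω / (R.Δ k ω j * Δ' k ω i)) 2 μ ≤ ENNReal.ofReal ρ)
    (hmy : ∀ k, eLpNorm (fun ω => y k ω / (R.Δ k ω j * Δ' k ω i)) 2 μ ≤ ENNReal.ofReal ρ) :
    ∀ᵐ ω ∂μ, SeriesConverges fun k =>
      g.w k / (2 * g.c k * c' k) * (R.Δ k ω j * Δ' k ω i)⁻¹ *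
      ((yt k ω - y k ω) - (loss (z k ω + c' k • Δ' k ω) - loss (z k ω))) := by
  set 𝒢 : ℕ → MeasurableSpace Ω := fun k => (ℱ k ⊔ MeasurableSpace.comap (R.Δ k) inferInstance)
    ⊔ MeasurableSpace.comap (Δ' k) inferInstance
  have hle : ∀ k, ℱ k ≤ 𝒢 k := fun k => le_sup_left.trans le_sup_left
  have hle' : ∀ k, 𝒢 k ≤ ℱ (k + 1) := fun k => sup_le (sup_le (ℱ.mono k.le_succ)
    (Measurable.comap_le (h.measurable_Δ k))) (Measurable.comap_le (h.measurable_Δ' k))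
  have hΔ : ∀ k, Measurable[𝒢 k] (R.Δ k) := fun k =>
    (comap_measurable (R.Δ k)).mono (le_sup_right.trans le_sup_left) le_rfl
  have hΔ' : ∀ k, Measurable[𝒢 k] (Δ' k) := fun k =>
    (comap_measurable (Δ' k)).mono le_sup_right le_rfl
  have hzm : ∀ k, Measurable[𝒢 k] (z k) := fun k => (hz k).mono le_sup_left le_rfl
  have hl : Measurable loss := hloss.continuous.measurable
  have hprod : ∀ k, Measurable[𝒢 k] fun ω => R.Δ k ω j * Δ' k ω i := fun k =>
    (measurable_vec_apply (hΔ k) j).mul (measurable_vec_apply (hΔ' k) i)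
  have hprod' : ∀ k, Measurable[ℱ (k + 1)] fun ω => R.Δ k ω j * Δ' k ω i := fun k =>
    (hprod k).mono (hle' k) le_rfl
  have hp : ∀ k, MemLp (fun ω => yt k ω / (R.Δ k ω j * Δ' k ω i)) 2 μ ∧
      ∫ ω, (yt k ω / (R.Δ k ω j * Δ' k ω i)) ^ 2 ∂μ ≤ ρ ^ 2 := fun k =>
    memLp_and_integral_sq_le
      (((hyt k).div (hprod' k)).mono (ℱ.le _) le_rfl).aestronglyMeasurable (hmyt k)
  have hm : ∀ k, MemLp (fun ω => y k ω / (R.Δ k ω j * Δ' k ω i)) 2 μ ∧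
      ∫ ω, (y k ω / (R.Δ k ω j * Δ' k ω i)) ^ 2 ∂μ ≤ ρ ^ 2 := fun k =>
    memLp_and_integral_sq_le
      (((hy k).div (hprod' k)).mono (ℱ.le _) le_rfl).aestronglyMeasurable (hmy k)
  have hdiff : ∀ k, MemLp (fun ω => yt k ω / (R.Δ k ω j * Δ' k ω i)
      - y k ω / (R.Δ k ω j * Δ' k ω i)) 2 μ := fun k => (hp k).1.sub (hm k).1
  have hΔL : ∀ k, MemLp (fun ω => R.Δ k ω j * Δ' k ω i) 2 μ := fun k =>
    (h.perturbation.memLp k (Sum.inr i) 2).mul' (h.perturbation.memLp k (Sum.inl j) ⊤)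
  have hZ : ∀ k, Integrable (fun ω => yt k ω - y k ω) μ := by
    intro k
    refine ((hΔL k).integrable_mul (hdiff k)).congr ?_
    filter_upwards [h.perturbation.ne_zero k (Sum.inl j), h.perturbation.ne_zero k (Sum.inr i)]
      with ω h1 h2
    simp only [Sum.elim_inl, Sum.elim_inr] at h1 h2
    simp only [Pi.mul_apply]
    field_simp
  have hfZ : ∀ k ω, g.w k / (2 * g.c k * c' k) * (R.Δ k ω j * Δ' k ω i)⁻¹ * (yt k ω - y k ω)
      = g.w k / (2 * g.c k * c' k) * (yt k ω / (R.Δ k ω j * Δ' k ω i)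
        - y k ω / (R.Δ k ω j * Δ' k ω i)) := fun k ω => by
    simp only [div_eq_mul_inv]; ring
  have e : ∀ k, (fun ω => (yt k ω - loss (z k ω + c' k • Δ' k ω)) - (y k ω - loss (z k ω)))
      = fun ω => (yt k ω - y k ω) - (loss (z k ω + c' k • Δ' k ω) - loss (z k ω)) := fun k => by
    funext ω; ring
  refine SecondOrderSP.ae_seriesConverges_noise (μ := μ) ℱ hle hle'
    (fun k => (hprod k).inv.const_mul _)
    (fun k => (hl.comp ((hzm k).add ((hΔ' k).const_smul (c' k)))).sub (hl.comp (hzm k)))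
    (fun k => (hyt k).sub (hy k)) hZ (fun k => e k ▸ (hiyt k).sub (hiy k))
    (fun k => e k ▸ hnoise k) (fun k => ?_) ?_
  · simp only [hfZ]
    exact (hdiff k).const_mul _
  · simp only [hfZ, mul_pow, integral_const_mul]
    refine (h.w_summable.mul_right (ρ ^ 2)).of_nonneg_of_le
      (fun k => mul_nonneg (sq_nonneg _) (integral_nonneg fun ω => sq_nonneg _)) fun k => ?_
    have h1 := integral_sub_sq_le (hp k).1 (hm k).1 (hp k).2 (hm k).2
    refine (mul_le_mul_of_nonneg_left h1 (sq_nonneg _)).trans_eq ?_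
    have := (hg.c_pos k).ne'
    have := (h.c'_pos k).ne'
    field_simp
    norm_num

/-- Four parts: the noise of the two one-sided differences (`hA1`, `hA2`), fluctuations of products
of ratios (`hA3`) and the remainder of the double difference at `θs` (`hA4`). -/
theorem Is2SPSA.ae_averagesToZero (hloss : ContDiff ℝ 2 loss) (hg : g.Admissible)
    (hθm : ∀ k, Measurable[ℱ k] (R.θ k))
    (hθ : ∀ᵐ ω ∂μ, Tendsto (fun k => R.θ k ω - θs) atTop (𝓝 0))
    (h : Is2SPSA R μ ℱ g τ θs loss c' Δ' yp ym ytp ytm ρ) (i j : Fin p) :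
    ∀ᵐ ω ∂μ, AveragesToZero g.w fun k =>
      R.δG k ω i / (2 * g.c k) * (R.Δ k ω j)⁻¹ - hessian loss θs i j := by
  have hw := hg.isWeight
  have hcc : Tendsto (fun k => g.c k * c' k) atTop (𝓝 0) := by
    simpa using hg.c_tendsto.mul h.c'_tendsto
  have hw2 := summable_sq_of_summable_div_sq (fun k => mul_pos (hg.c_pos k) (h.c'_pos k)) hcc
    h.w_summable
  set X : ℕ → Fin p ⊕ Fin p → Ω → ℝ :=
    fun k s ω => Sum.elim (fun i => R.Δ k ω i) (fun i => Δ' k ω i) s with hX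
  have hpert : IsPerturbation μ ℱ X ρ := h.perturbation
  have hmc := fun k s => IsPerturbation.measurable_comap X k s
  have hΔm : ∀ k, Measurable[ℱ k ⊔ MeasurableSpace.comap (R.Δ k) inferInstance] (R.Δ k) :=
    fun k => (comap_measurable (R.Δ k)).mono le_sup_right le_rfl
  have hθm' : ∀ k, Measurable[ℱ k ⊔ MeasurableSpace.comap (R.Δ k) inferInstance] (R.θ k) :=
    fun k => (hθm k).mono le_sup_left le_rfl
  have hplus := h.ae_seriesConverges_noise hloss hg i j
    (yt := ytp) (y := yp) (z := fun k ω => R.θ k ω + g.c k • R.Δ k ω) h.meas_ytp h.meas_yp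
    (fun k => (hθm' k).add ((hΔm k).const_smul (g.c k))) h.int_ytp h.int_yp h.noise_plus
    (fun k => h.moment_ytp k j i) (fun k => h.moment_yp' k j i)
  have hminus := h.ae_seriesConverges_noise hloss hg i j
    (yt := ytm) (y := ym) (z := fun k ω => R.θ k ω - g.c k • R.Δ k ω) h.meas_ytm h.meas_ym
    (fun k => (hθm' k).sub ((hΔm k).const_smul (g.c k))) h.int_ytm h.int_ym h.noise_minus
    (fun k => h.moment_ytm k j i) (fun k => h.moment_ym' k j i)
  have hratio : ∀ l m, ∀ᵐ ω ∂μ, SeriesConverges fun k =>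
      g.w k * ((X k (Sum.inr l) ω * (X k (Sum.inr i) ω)⁻¹)
        * (X k (Sum.inl m) ω * (X k (Sum.inl j) ω)⁻¹)
        - (if l = i then 1 else 0) * (if m = j then 1 else 0)) := by
    intro l m
    -- The `Δ'` ratio and the `Δ` ratio use disjoint index pairs, so they are independent and the
    -- mean of the product is a product of deltas.
    have hI : ∀ k, IndepFun (fun ω => X k (Sum.inr l) ω * (X k (Sum.inr i) ω)⁻¹)
        (fun ω => X k (Sum.inl m) ω * (X k (Sum.inl j) ω)⁻¹) μ := fun k =>
      ((hpert.indep k).indepFun_prodMk_prodMk (hpert.measurable k) (Sum.inr l) (Sum.inr i)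
        (Sum.inl m) (Sum.inl j) (by simp) (by simp) (by simp) (by simp)).comp
        (φ := fun x : ℝ × ℝ => x.1 * x.2⁻¹) (ψ := fun x : ℝ × ℝ => x.1 * x.2⁻¹)
        (by fun_prop) (by fun_prop)
    have h1 := fun k => hpert.memLp_ratio k (Sum.inr l) (Sum.inr i)
    have h2 := fun k => hpert.memLp_ratio k (Sum.inl m) (Sum.inl j)
    have h3 := fun k => memLp_mul_of_indepFun (hI k) (h1 k).1 (h2 k).1
    have := ae_seriesConverges_indep (μ := μ) ℱ hpert.comap_le hpert.indep_past
      (Y := fun k ω => (X k (Sum.inr l) ω * (X k (Sum.inr i) ω)⁻¹)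
        * (X k (Sum.inl m) ω * (X k (Sum.inl j) ω)⁻¹))
      (fun k => ((hmc k _).mul (hmc k _).inv).mul ((hmc k _).mul (hmc k _).inv))
      (fun k => (h3 k).1) (C := (ρ ^ 2 * ρ ^ 2) * (ρ ^ 2 * ρ ^ 2)) (fun k => (h3 k).2.trans_le
        (mul_le_mul (h1 k).2 (h2 k).2 (integral_nonneg fun ω => sq_nonneg _) (by positivity))) hw2
    have hint : ∀ k, ∫ ω, (X k (Sum.inr l) ω * (X k (Sum.inr i) ω)⁻¹)
        * (X k (Sum.inl m) ω * (X k (Sum.inl j) ω)⁻¹) ∂μ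
        = (if l = i then 1 else 0) * (if m = j then 1 else 0) := fun k => by
      rw [(hI k).integral_fun_mul_eq_mul_integral (h1 k).1.1 (h2 k).1.1, hpert.integral_ratio,
        hpert.integral_ratio]
      simp only [Sum.inr.injEq, Sum.inl.injEq]
    simpa only [hint] using this
  have hrem : ∀ᵐ ω ∂μ, ∀ Z : ℕ → ℝ, (∀ ε : ℝ, 0 < ε → ∀ᶠ k in atTop,
      |Z k| ≤ ε * |(X k (Sum.inl j) ω)⁻¹ * (X k (Sum.inr i) ω)⁻¹|) → AveragesToZero g.w Z := by
    have hI : ∀ k, IndepFun (fun ω => (X k (Sum.inl j) ω)⁻¹) (fun ω => (X k (Sum.inr i) ω)⁻¹) μ :=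
      fun k => ((hpert.indep k).indepFun (by simp : Sum.inl j ≠ Sum.inr i)).comp
        measurable_inv measurable_inv
    have h1 := fun k => hpert.memLp_inv k (Sum.inl j)
    have h2 := fun k => hpert.memLp_inv k (Sum.inr i)
    have h3 := fun k => memLp_mul_of_indepFun (hI k) (h1 k).1 (h2 k).1
    exact ae_averagesToZero_of_small (μ := μ) hw hw2 hpert.comap_le hpert.indep_past
      (Y := fun k ω => (X k (Sum.inl j) ω)⁻¹ * (X k (Sum.inr i) ω)⁻¹)
      (fun k => (hmc k _).inv.mul (hmc k _).inv)
      (fun k => (h3 k).1) (S := ρ ^ 2 * ρ ^ 2) (fun k => (h3 k).2.trans_le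
        (mul_le_mul (h1 k).2 (h2 k).2 (integral_nonneg fun ω => sq_nonneg _) (by positivity)))
  filter_upwards [hθ, hplus, hminus, ae_all_iff.2 fun l => ae_all_iff.2 fun m => hratio l m, hrem,
    ae_all_iff.2 fun k => ae_all_iff.2 fun s => hpert.bdd k s] with ω eθ eP eM eR erem eb
  simp only [hX, Sum.elim_inl, Sum.elim_inr] at eR erem
  set K : ℝ := √(p * ρ ^ 2) with hK
  have hΔK : ∀ k, ‖R.Δ k ω‖ ≤ K := fun k => norm_le_of_abs_le fun i => eb k (Sum.inl i)
  have hΔK' : ∀ k, ‖Δ' k ω‖ ≤ K := fun k => norm_le_of_abs_le fun i => eb k (Sum.inr i)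
  set b : ℕ → ℝ := fun k => 1 / (2 * g.c k * c' k) * (R.Δ k ω j * Δ' k ω i)⁻¹ with hb
  set lp : ℕ → ℝ := fun k => loss (R.θ k ω + g.c k • R.Δ k ω + c' k • Δ' k ω)
    - loss (R.θ k ω + g.c k • R.Δ k ω) with hlp
  set lm : ℕ → ℝ := fun k => loss (R.θ k ω - g.c k • R.Δ k ω + c' k • Δ' k ω)
    - loss (R.θ k ω - g.c k • R.Δ k ω) with hlm
  set q : ℕ → ℝ := fun k => ∑ l, ∑ m, Δ' k ω l * R.Δ k ω m * hessian loss θs l m with hq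
  have hA1 : AveragesToZero g.w fun k => b k * ((ytp k ω - yp k ω) - lp k) := by
    refine hw.averagesToZero_of_seriesConverges ?_
    refine (congrArg SeriesConverges (funext fun k => ?_)).mp eP
    simp only [hb, hlp]
    ring
  have hA2 : AveragesToZero g.w fun k => b k * ((ytm k ω - ym k ω) - lm k) := by
    refine hw.averagesToZero_of_seriesConverges ?_
    refine (congrArg SeriesConverges (funext fun k => ?_)).mp eM
    simp only [hb, hlm]
    ring
  have h0 : AveragesToZero g.w fun _ => 0 := hw.averagesToZero_of_tendsto tendsto_const_nhds
  have hA3 : AveragesToZero g.w fun k => ∑ l, ∑ m, hessian loss θs l m *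
      ((Δ' k ω l * (Δ' k ω i)⁻¹) * (R.Δ k ω m * (R.Δ k ω j)⁻¹)
        - (if l = i then 1 else 0) * (if m = j then 1 else 0)) :=
    AveragesToZero.sum Finset.univ h0 fun l _ => AveragesToZero.sum Finset.univ h0 fun m _ =>
      (hw.averagesToZero_of_seriesConverges (eR l m)).const_mul _
  have hA4 : AveragesToZero g.w fun k => b k * (lp k - lm k - 2 * g.c k * c' k * q k) := by
    refine erem _ fun ε hε => ?_
    have hK1 : 0 < K + 1 := by positivity
    -- The remainder carries `‖Δ‖ * ‖Δ'‖ ≤ (K + 1) ^ 2`, which this tolerance cancels.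
    obtain ⟨δ, hδ, hd⟩ := exists_double_diff_le hloss θs (ε := ε / (K + 1) ^ 2) (by positivity)
    have hlim : Tendsto (fun k => ‖R.θ k ω - θs‖ + g.c k * ‖R.Δ k ω‖ + c' k * ‖Δ' k ω‖) atTop
        (𝓝 0) := by
      simpa using (eθ.norm.add (tendsto_mul_norm_of_le hg.c_pos hg.c_tendsto hΔK)).add
        (tendsto_mul_norm_of_le h.c'_pos h.c'_tendsto hΔK')
    filter_upwards [hlim.eventually (gt_mem_nhds hδ)] with k hk
    have h1 := hd _ _ _ _ _ (hg.c_pos k) (h.c'_pos k) hk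
    have hc := hg.c_pos k
    have hc' := h.c'_pos k
    have hbk : |b k| = 1 / (2 * g.c k * c' k) * |(R.Δ k ω j)⁻¹ * (Δ' k ω i)⁻¹| := by
      simp only [hb]
      rw [abs_mul, abs_of_pos (by positivity : 0 < 1 / (2 * g.c k * c' k)), mul_inv]
    have h2 : ‖R.Δ k ω‖ * ‖Δ' k ω‖ ≤ (K + 1) ^ 2 := by
      rw [pow_two]
      exact mul_le_mul (by linarith [hΔK k]) (by linarith [hΔK' k]) (norm_nonneg _) hK1.le
    rw [abs_mul, hbk]
    calc 1 / (2 * g.c k * c' k) * |(R.Δ k ω j)⁻¹ * (Δ' k ω i)⁻¹| * _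
        ≤ 1 / (2 * g.c k * c' k) * |(R.Δ k ω j)⁻¹ * (Δ' k ω i)⁻¹| *
          (ε / (K + 1) ^ 2 * (2 * g.c k * c' k * (K + 1) ^ 2)) := by
          refine mul_le_mul_of_nonneg_left (h1.trans ?_) (by positivity)
          gcongr
      _ = ε * |(R.Δ k ω j)⁻¹ * (Δ' k ω i)⁻¹| := by field_simp
  refine (congrArg (AveragesToZero g.w) (funext fun k => ?_)).mp
    (((hA1.add (hA2.const_mul (-1))).add hA3).add hA4)
  have e1 : ∑ l, ∑ m, hessian loss θs l m *
      ((Δ' k ω l * (Δ' k ω i)⁻¹) * (R.Δ k ω m * (R.Δ k ω j)⁻¹)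
        - (if l = i then 1 else 0) * (if m = j then 1 else 0))
      = (R.Δ k ω j * Δ' k ω i)⁻¹ * q k - hessian loss θs i j := by
    simp only [mul_sub, Finset.sum_sub_distrib]
    congr 1
    · simp only [hq, Finset.mul_sum]
      exact Finset.sum_congr rfl fun l _ => Finset.sum_congr rfl fun m _ => by
        rw [mul_inv]; ring
    · simp
  have e2 : b k * (2 * g.c k * c' k * q k) = (R.Δ k ω j * Δ' k ω i)⁻¹ * q k := by
    have := (hg.c_pos k).ne'
    have := (h.c'_pos k).ne'
    simp only [hb]
    field_simp
  have e3 : R.δG k ω i / (2 * g.c k) * (R.Δ k ω j)⁻¹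
      = b k * (ytp k ω - yp k ω) - b k * (ytm k ω - ym k ω) := by
    rw [h.δG_eq]
    simp only [hb, oneSidedGrad, recip, PiLp.sub_apply, PiLp.smul_apply, smul_eq_mul,
      div_eq_mul_inv, mul_inv]
    ring
  rw [e1, e3, mul_sub (b k) _ (2 * g.c k * c' k * q k), e2]
  ring

end Hessian

end SecondOrderSP

end

/-! ### Assembly of the two settings -/

theorem theorem3
    {Ω : Type*} {mΩ : MeasurableSpace Ω} (μ : Measure Ω) [IsProbabilityMeasure μ]
    (ℱ : Filtration ℕ mΩ)
    (p : ℕ) (hp : 0 < p)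
    (loss : SecondOrderSP.Vec p → ℝ) (hloss : ContDiff ℝ 2 loss)
    (θs : SecondOrderSP.Vec p) (hroot : gradient loss θs = 0)
    (hpos : (SecondOrderSP.hessian loss θs).PosDef)
    (g : SecondOrderSP.Gains) (hg : g.Admissible)
    (τ σbar : ℝ) (hσ : 0 < σbar) (hτ : 0 < τ)
    (hτle : τ ≤ SecondOrderSP.lambdaMin hpos.isHermitian / (2 * σbar ^ 2))
    (θ₀ : SecondOrderSP.Vec p) (H₀ : SecondOrderSP.Mat p) (hH₀ : H₀.IsSymm)
    (R : SecondOrderSP.Run Ω p)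
    (hR : R.Follows g τ θ₀ H₀)
    (hL : ∀ k ω, SecondOrderSP.sigmaMax (R.L k ω) ≤ σbar)
    (hmeas : ∀ k i j, Measurable[ℱ (k + 1)] (fun ω => R.Hbb τ k ω i j))
    (hsetting :
      (∃ (c' : ℕ → ℝ) (Δ' : ℕ → Ω → SecondOrderSP.Vec p) (yp ym ytp ytm : ℕ → Ω → ℝ) (ρ : ℝ),
        SecondOrderSP.Is2SPSA R μ ℱ g τ θs loss c' Δ' yp ym ytp ytm ρ) ∨
      (∃ (Y Yp Ym : ℕ → Ω → SecondOrderSP.Vec p) (ρ : ℝ),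
        SecondOrderSP.Is2SG R μ ℱ g τ θs loss Y Yp Ym ρ)) :
    ∀ᵐ ω ∂μ, ∃ K₁ : ℕ, ∀ k : ℕ, K₁ < k → R.Hbb τ k ω = R.Hbar k ω := by
  have : NeZero p := ⟨hp.ne'⟩
  obtain ⟨C, _, hC⟩ := SecondOrderSP.exists_abs_inv_Hbb_le hR hτ hL
  have havg : ∀ i j, ∀ᵐ ω ∂μ, SecondOrderSP.AveragesToZero g.w fun k =>
      R.δG k ω i / (2 * g.c k) * (R.Δ k ω j)⁻¹ - SecondOrderSP.hessian loss θs i j := by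
    rcases hsetting with ⟨c', Δ', yp, ym, ytp, ytm, ρ, h⟩ | ⟨Y, Yp, Ym, ρ, h⟩
    · exact fun i j => h.ae_averagesToZero hloss hg
        (SecondOrderSP.measurable_theta hR hmeas h.measurable_G)
        (h.ae_tendsto_theta hg hR hmeas hC) i j
    · have hG : ∀ k i, Measurable[ℱ (k + 1)] fun ω => R.G k ω i := fun k i => by
        simpa only [h.G_eq] using SecondOrderSP.measurable_vec_apply (h.meas_Y k) i
      exact fun i j => h.ae_averagesToZero hloss hg (SecondOrderSP.measurable_theta hR hmeas hG)
        hpos.isHermitian (h.ae_tendsto_theta hloss hg hR hmeas hC) i j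
  filter_upwards [ae_all_iff.2 fun i => ae_all_iff.2 fun j => havg i j] with ω hω
  exact hR.eventually_Hbb_eq hσ hτ.le hL hpos hτle (hR.tendsto_hbar hpos.isHermitian hω)
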